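/- Let $p$ be a prime power, $\mathbb F_p$ a field with $p$ elements, $d\ge 0$, and $\mathbb k$ any field. For finite sets $A,B$ let $S=\mathbb k[x_{a,b}:a\in A,b\in B]$; for a partial function $\mathsf g$ from $A$ to $B$ let $\Gamma\mathsf g\subseteq A\times B$ be the complement of its graph. The canonical ideal $I^\star_{\mathcal C}$ of a class $\mathcal C$ of functions $A\to B$ is the Alexander dual of the Stanley–Reisner ideal of the simplicial complex on $A\times B$ whose faces are the subsets of graphs of members of $\mathcal C$ (it is generated by the monomials $\mathbf x^{\Gamma f}$, $f\in\mathcal C$), and $\beta_{i,\mathsf g}(\mathcal C):=\beta_{i,\Gamma\mathsf g}(I^\star_{\mathcal C})$ is the multiplicity of $S(-\Gamma\mathsf g)$ in homological degree $i$ of a minimal $\mathbb N^{A\times B}$-graded free resolution of $I^\star_{\mathcal C}$. Let $\mathrm{LINFUN}_d^p$ be the class of all linear functionals $\mathbb F_p^d\to\mathbb F_p$. For a linear order $\lhd$ on the dual space $(\mathbb F_p^d)^*$, consider pairs $(f,V)$ with $V$ an affine subspace of $(\mathbb F_p^d)^*$ and $f$ the $\lhd$-least element of $V$. Call $(g,W)$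 a child of $(f,V)$ if $W\subset V$ is an affine subspace of codimension $1$ in $V$ with $f\notin W$. A maximal path is a sequence $(f_1,V_1),\dots,(f_{d+1},V_{d+1})$ with $V_1=(\mathbb F_p^d)^*$, each pair after the first being a child of the previous one (so $V_{d+1}=\{f_{d+1}\}$). Let $X$ be the simplicial complex with vertex set $(\mathbb F_p^d)^*$ whose faces are the subsets of the sets $\{f_1,\dots,f_{d+1}\}$ for all maximal paths, each vertex $f$ having exponent label $\Gamma f$ and each face the coordinatewise maximum of the labels of its vertices. Theorem. (1) For every linear order $\lhd$, $X$ has dimension $d$, and the cellular free complex supported on $X$ (its reduced chain complex homogenized by the labels, with the empty face in homological degree $0$) is a minimal $\mathbb N^{A\times B}$-graded free resolution of $S/I^\star_{\mathrm{LINFUN}_d^p}$, where $A=\mathbb F_p^d$, $B=\mathbb F_p$. (2) For every $i\ge 0$ and every partial function $\mathsf g$ from $\mathbb F_p^d$ to $\mathbb F_p$, the Betti number $\beta_{i,\mathsf g}(\mathrm{LINFUN}_d^p)$ is nonzero only if $\mathsf g$ is a linear functional on a linear subspace $\operatorname{dom}\mathsf g$ of $\mathbb F_p^d$ and $i=d-\dim\operatorname{dom}\mathsf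 g$; in that case $$\beta_{i,\mathsf g}(\mathrm{LINFUN}_d^p)=\mathcal U_p(i):=\prod_{j=0}^{i-1}(p^{\,i-j}-1).$$ -/

import Mathlib

open MvPolynomial

universe u v

noncomputable section

/-! ### Multigraded free complexes, minimal free resolutions, Betti numbers -/

/-- A bounded complex `0 ← F₀ ← F₁ ← ⋯` of finitely generated `ℕ^σ`-graded free modules over
`k[x_s : s ∈ σ]`, given with homogeneous bases: `F_i` is free on `basis i`, the basis element `b`
has degree `deg i b`, and the differentials are degree-preserving. -/
structure GradedFreeComplex (k : Type v) [Field k] (σ : Type u) where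
  basis : ℕ → Type u
  finite_basis : ∀ i, Finite (basis i)
  bounded : ∃ l, ∀ i, l < i → IsEmpty (basis i)
  deg : ∀ i, basis i → (σ →₀ ℕ)
  d : ∀ i, (basis (i + 1) →₀ MvPolynomial σ k) →ₗ[MvPolynomial σ k]
    (basis i →₀ MvPolynomial σ k)
  /-- The entry of `d` from `b` to `c` is a scalar multiple of `x ^ (deg b - deg c)`. -/
  homogeneous : ∀ i (b : basis (i + 1)) (c : basis i) (m : σ →₀ ℕ),
    coeff m (d i (Finsupp.single b 1) c) ≠ 0 → m + deg i c = deg (i + 1) b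
  d_comp_d : ∀ i, d i ∘ₗ d (i + 1) = 0

namespace GradedFreeComplex

variable {k : Type v} [Field k] {σ : Type u}

/-- The multiplicity of the summand `S(-a)` in `F_i`. -/
def mult (C : GradedFreeComplex k σ) (i : ℕ) (a : σ →₀ ℕ) : ℕ :=
  Nat.card {b : C.basis i // C.deg i b = a}

/-- `C` is a free resolution of the `ℕ^σ`-graded module `M` (with graded pieces `𝓜 a`): it is
exact in positive homological degrees, and `F₀ / im F₁` is `M` as a graded module. -/
def IsResolution (C : GradedFreeComplex k σ) (M : Type*) [AddCommGroup M]
    [Module (MvPolynomial σ k) M] (𝓜 : (σ →₀ ℕ) → AddSubgroup M) : Prop :=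
  (∀ i, LinearMap.ker (C.d i) = LinearMap.range (C.d (i + 1))) ∧
  ∃ ε : (C.basis 0 →₀ MvPolynomial σ k) →ₗ[MvPolynomial σ k] M,
    Function.Surjective ε ∧
    LinearMap.ker ε = LinearMap.range (C.d 0) ∧
    ∀ b, ε (Finsupp.single b 1) ∈ 𝓜 (C.deg 0 b)

/-- `C` is minimal: every differential has image in `𝔪 F_i`, with `𝔪 = ⟨x_s : s ∈ σ⟩`. -/
def IsMinimal (C : GradedFreeComplex k σ) : Prop :=
  ∀ i, LinearMap.range (C.d i) ≤
    Ideal.span (Set.range (X : σ → MvPolynomial σ k)) •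
      (⊤ : Submodule (MvPolynomial σ k) (C.basis i →₀ MvPolynomial σ k))

/-- `C` is a minimal free resolution of the graded module `M`. -/
def IsMinimalResolution (C : GradedFreeComplex k σ) (M : Type*) [AddCommGroup M]
    [Module (MvPolynomial σ k) M] (𝓜 : (σ →₀ ℕ) → AddSubgroup M) : Prop :=
  C.IsResolution M 𝓜 ∧ C.IsMinimal

end GradedFreeComplex

section Betti

variable {k : Type v} [Field k] {σ : Type u}

/-- The degree-`a` piece `k · x^a` of `k[x_s : s ∈ σ]`. -/
def monomialPiece (k : Type v) [Field k] {σ : Type u} (a : σ →₀ ℕ) :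
    AddSubgroup (MvPolynomial σ k) :=
  (LinearMap.range (monomial a : k →ₗ[k] MvPolynomial σ k)).toAddSubgroup

/-- The `ℕ^σ`-grading of a (monomial) ideal. -/
def idealPiece (I : Ideal (MvPolynomial σ k)) (a : σ →₀ ℕ) : AddSubgroup I :=
  (monomialPiece k a).comap (Submodule.subtype I).toAddMonoidHom

/-- The `ℕ^σ`-grading of the quotient by a (monomial) ideal. -/
def quotientPiece (I : Ideal (MvPolynomial σ k)) (a : σ →₀ ℕ) :
    AddSubgroup (MvPolynomial σ k ⧸ I) :=
  (monomialPiece k a).map (Submodule.mkQ I).toAddMonoidHom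

open Classical in
/-- The Betti number `β_{i,a}(M)`: the multiplicity of `S(-a)` in the `i`-th term of a minimal
graded free resolution of `M`, which does not depend on the resolution (and `0` when there is
none). -/
def bettiNumber (M : Type*) [AddCommGroup M] [Module (MvPolynomial σ k) M]
    (𝓜 : (σ →₀ ℕ) → AddSubgroup M) (i : ℕ) (a : σ →₀ ℕ) : ℕ :=
  if h : ∃ C : GradedFreeComplex k σ, C.IsMinimalResolution M 𝓜 then h.choose.mult i a else 0

end Betti

/-! ### Simplicial complexes and their cellular free complexes -/

/-- An abstract simplicial complex, given by its set of faces, closed under taking subsets. The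
empty face is a face (of dimension `-1`) unless the complex is void. -/
abbrev SimplicialCplx (V : Type u) := LowerSet (Finset V)

namespace SimplicialCplx

/-- The maximal dimension of a face of `X` is `n`. -/
def HasDim {V : Type u} (X : SimplicialCplx V) (n : ℤ) : Prop :=
  IsGreatest {m : ℤ | ∃ A ∈ X, (A.card : ℤ) - 1 = m} n

section Cellular

variable {V : Type u} [LinearOrder V] {σ : Type u}

/-- The faces with `i` vertices. -/
def Cells (X : SimplicialCplx V) (i : ℕ) : Type u := {A : Finset V // A ∈ X ∧ A.card = i}

/-- The exponent label of a face: the coordinatewise maximum of the labels of its vertices. -/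
def faceLabel (label : V → (σ →₀ ℕ)) (A : Finset V) : σ →₀ ℕ := A.sup label

/-- The incidence sign of the facet `A \ {v}` of `A`. -/
def sgn (A : Finset V) (v : V) : ℤ := (-1) ^ (A.filter (· < v)).card

/-- The facet `A \ {v}`. -/
def Cells.erase {X : SimplicialCplx V} {i : ℕ} (A : X.Cells (i + 1)) (v : V) (hv : v ∈ A.1) :
    X.Cells i :=
  ⟨A.1.erase v, X.lower (Finset.erase_subset v A.1) A.2.1, by
    rw [Finset.card_erase_of_mem hv, A.2.2]; rfl⟩

/-- The homogenized boundary `∂ e_A = ∑_{v ∈ A} ± x^{a_A - a_{A \ v}} e_{A \ v}`. -/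
def bdry (k : Type v) [Field k] (X : SimplicialCplx V) (label : V → (σ →₀ ℕ)) (i : ℕ) :
    (X.Cells (i + 1) →₀ MvPolynomial σ k) →ₗ[MvPolynomial σ k]
      (X.Cells i →₀ MvPolynomial σ k) :=
  Finsupp.linearCombination (MvPolynomial σ k) fun A : X.Cells (i + 1) =>
    ∑ v ∈ A.1.attach, Finsupp.single (A.erase v.1 v.2)
      (monomial (faceLabel label A.1 - faceLabel label (A.1.erase v.1)) ((sgn A.1 v.1 : ℤ) : k))

theorem faceLabel_erase_le (label : V → (σ →₀ ℕ)) (A : Finset V) (v : V) :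
    faceLabel label (A.erase v) ≤ faceLabel label A :=
  Finset.sup_mono (Finset.erase_subset v A)

theorem bdry_single (k : Type v) [Field k] (X : SimplicialCplx V) (label : V → (σ →₀ ℕ)) (i : ℕ)
    (A : X.Cells (i + 1)) (c : MvPolynomial σ k) :
    bdry k X label i (Finsupp.single A c) =
      ∑ v ∈ A.1.attach, Finsupp.single (A.erase v.1 v.2)
        (c * monomial (faceLabel label A.1 - faceLabel label (A.1.erase v.1))
          ((sgn A.1 v.1 : ℤ) : k)) := by
  simp [bdry, Finsupp.linearCombination_single, Finset.smul_sum]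

theorem sgn_swap (A : Finset V) {v w : V} (hv : v ∈ A) (hw : w ∈ A) (hvw : v ≠ w) :
    sgn A v * sgn (A.erase v) w = -(sgn A w * sgn (A.erase w) v) := by
  wlog h : w < v generalizing v w
  · rw [this hw hv hvw.symm (lt_of_le_of_ne (not_lt.mp h) hvw), neg_neg]
  have h1 : (A.erase v).filter (· < w) = A.filter (· < w) := by
    ext x; simp only [Finset.mem_filter, Finset.mem_erase]
    exact ⟨fun y => ⟨y.1.2, y.2⟩, fun y => ⟨⟨(y.2.trans h).ne, y.1⟩, y.2⟩⟩
  have h2 : (A.erase w).filter (· < v) = (A.filter (· < v)).erase w := by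
    ext x; simp only [Finset.mem_filter, Finset.mem_erase]; tauto
  have h3 : w ∈ A.filter (· < v) := by simp [hw, h]
  have h4 := Finset.card_erase_add_one h3
  unfold sgn
  rw [h1, h2, ← h4, pow_succ]
  ring

theorem bdry_comp_bdry (k : Type v) [Field k] (X : SimplicialCplx V) (label : V → (σ →₀ ℕ))
    (i : ℕ) : bdry k X label i ∘ₗ bdry k X label (i + 1) = 0 := by
  refine Finsupp.lhom_ext fun A c => ?_
  rw [LinearMap.comp_apply, bdry_single, map_sum, LinearMap.zero_apply]
  simp only [bdry_single]
  rw [Finset.sum_sigma']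
  refine Finset.sum_involution
    (fun x _ => ⟨⟨x.2.1, Finset.mem_of_mem_erase x.2.2⟩,
      ⟨x.1.1, Finset.mem_erase.2 ⟨(Finset.ne_of_mem_erase x.2.2).symm, x.1.2⟩⟩⟩) ?_ ?_ ?_ ?_
  · rintro ⟨⟨v, hv⟩, ⟨w, hw⟩⟩ -
    have hwv : w ≠ v := Finset.ne_of_mem_erase hw
    have hwA : w ∈ A.1 := Finset.mem_of_mem_erase hw
    have e1 : (A.erase v hv).erase w hw =
        (A.erase w hwA).erase v (Finset.mem_erase.2 ⟨hwv.symm, hv⟩) :=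
      Subtype.ext (Finset.erase_right_comm ..)
    have e2 : (A.1.erase v).erase w = (A.1.erase w).erase v := Finset.erase_right_comm ..
    simp only
    rw [e1, ← Finsupp.single_add]
    refine (congrArg _ ?_).trans (Finsupp.single_zero _)
    simp only [Cells.erase]
    rw [mul_assoc, mul_assoc, monomial_mul, monomial_mul,
      tsub_add_tsub_cancel (faceLabel_erase_le _ _ _) (faceLabel_erase_le _ _ _),
      tsub_add_tsub_cancel (faceLabel_erase_le _ _ _) (faceLabel_erase_le _ _ _), e2,
      ← mul_add, ← map_add]
    have := sgn_swap A.1 hv hwA hwv.symm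
    rw [← Int.cast_mul, ← Int.cast_mul, this]
    simp
  · rintro ⟨⟨v, hv⟩, ⟨w, hw⟩⟩ - - h
    have hwv : w ≠ v := Finset.ne_of_mem_erase hw
    exact hwv (congrArg (fun x => x.1.1) h)
  · rintro ⟨⟨v, hv⟩, ⟨w, hw⟩⟩ -
    simp
  · rintro ⟨⟨v, hv⟩, ⟨w, hw⟩⟩ -
    rfl

/-- The cellular free complex supported on the labelled complex `(X, label)`: the reduced chain
complex of `X`, homogenized by the labels, with the empty face in homological degree `0`. -/
def cellularComplex [Finite V] (k : Type v) [Field k] (X : SimplicialCplx V)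
    (label : V → (σ →₀ ℕ)) : GradedFreeComplex k σ where
  basis := X.Cells
  finite_basis i := Subtype.finite
  bounded := by
    have := Fintype.ofFinite V
    exact ⟨Fintype.card V, fun i hi => ⟨fun A => by
      have := A.1.card_le_univ; have := A.2.2; omega⟩⟩
  deg i A := faceLabel label A.1
  d i := bdry k X label i
  homogeneous i A B m h := by
    rw [bdry_single, Finsupp.finsetSum_apply, coeff_sum] at h
    obtain ⟨v, -, hv⟩ := Finset.exists_ne_zero_of_sum_ne_zero h
    classical
    rw [Finsupp.single_apply] at hv
    split_ifs at hv with hB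
    · rw [one_mul, coeff_monomial] at hv
      split_ifs at hv with hm
      · subst hB
        rw [← hm]
        exact tsub_add_cancel_of_le (faceLabel_erase_le _ _ _)
      · exact absurd rfl hv
    · simp at hv
  d_comp_d i := bdry_comp_bdry k X label i

end Cellular

end SimplicialCplx

/-! ### The canonical ideal of a function class -/

section CanonicalIdeal

/-- The Stanley-Reisner ideal: generated by the squarefree monomials of the nonfaces. -/
def stanleyReisnerIdeal (k : Type v) [Field k] {V : Type u} (Δ : SimplicialCplx V) :
    Ideal (MvPolynomial V k) :=
  Ideal.span {f | ∃ τ : Finset V, τ ∉ Δ ∧ f = ∏ x ∈ τ, X x}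

/-- The Alexander dual of a squarefree monomial ideal: the intersection of the monomial primes
`⟨x_s : s ∈ τ⟩` over the squarefree monomials `x^τ ∈ I` (which generate `I`). -/
def alexanderDual {k : Type v} [Field k] {V : Type u} (I : Ideal (MvPolynomial V k)) :
    Ideal (MvPolynomial V k) :=
  ⨅ (τ : Finset V) (_ : ∏ x ∈ τ, (X x : MvPolynomial V k) ∈ I),
    Ideal.span ((X : V → MvPolynomial V k) '' (τ : Set V))

variable {A B : Type u}

/-- The canonical suboplex of a class of functions: the faces are the sets of pairs contained in
the graph of a member of the class. -/
def canonicalSuboplex (C : Set (A → B)) : SimplicialCplx (A × B) where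
  carrier := {τ | ∃ f ∈ C, ∀ x ∈ τ, f x.1 = x.2}
  lower' := by
    rintro τ τ' h ⟨f, hf, hτ⟩
    exact ⟨f, hf, fun x hx => hτ x (h hx)⟩

/-- The canonical ideal of a class of functions: the Alexander dual of the Stanley-Reisner ideal
of its canonical suboplex. -/
def canonicalIdeal (k : Type v) [Field k] (C : Set (A → B)) : Ideal (MvPolynomial (A × B) k) :=
  alexanderDual (stanleyReisnerIdeal k (canonicalSuboplex C))

open Classical in
/-- `Γ g`: the complement of the graph of the partial function `g`, as a squarefree exponent. -/
def coGraph [Finite A] [Finite B] (g : A →. B) : A × B →₀ ℕ :=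
  Finsupp.equivFunOnFinite.symm fun x => if x ∈ g.graph then 0 else 1

/-- The Betti number `β_{i,g}` of a class of functions: the Betti number of its canonical ideal
in homological degree `i` and degree `Γ g`. -/
def classBetti (k : Type v) [Field k] [Finite A] [Finite B] (C : Set (A → B)) (i : ℕ)
    (g : A →. B) : ℕ :=
  bettiNumber (k := k) (canonicalIdeal k C) (idealPiece (canonicalIdeal k C)) i (coGraph g)

end CanonicalIdeal

/-! ### Linear functionals over a finite field and the flag resolution -/

section Linfun

variable (F : Type u) [Field F] (d : ℕ)

/-- The class of linear functionals on `F^d`. -/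
def linfun : Set ((Fin d → F) → F) := {f | ∃ φ : Module.Dual F (Fin d → F), f = φ}

variable {F d} in
/-- A linear functional on a subspace of `F^d`, as a partial function on `F^d`. -/
def linearPFun (ℓ : (Fin d → F) →ₗ.[F] F) : (Fin d → F) →. F :=
  fun x => ⟨x ∈ ℓ.domain, fun h => ℓ ⟨x, h⟩⟩

variable [LinearOrder (Module.Dual F (Fin d → F))]

/-- A pair `(f, V)` of an affine subspace `V` of the dual space of `F^d` and its least element
`f`. -/
structure FlagNode where
  pt : Module.Dual F (Fin d → F)
  space : AffineSubspace F (Module.Dual F (Fin d → F))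
  isLeast : IsLeast (space : Set (Module.Dual F (Fin d → F))) pt

variable {F d} in
/-- `(g, W)` is a child of `(f, V)`: `W` is a codimension-1 affine subspace of `V` and `f ∉ W`. -/
def FlagNode.IsChild (m n : FlagNode F d) : Prop :=
  m.space ≤ n.space ∧
  Module.finrank F m.space.direction + 1 = Module.finrank F n.space.direction ∧
  n.pt ∉ m.space

variable {F d} in
/-- A path from the root `(f₁, (F^d)^*)` down to a leaf `(f_{d+1}, {f_{d+1}})`. -/
def IsMaximalPath (P : Fin (d + 1) → FlagNode F d) : Prop :=
  (P 0).space = ⊤ ∧ ∀ i : Fin d, (P i.succ).IsChild (P i.castSucc)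

/-- The simplicial complex on the covectors whose facets are the sets `{f₁, …, f_{d+1}}` for the
maximal paths `(f₁, V₁), …, (f_{d+1}, V_{d+1})`. -/
def flagComplex : SimplicialCplx (Module.Dual F (Fin d → F)) where
  carrier := {A | ∃ P : Fin (d + 1) → FlagNode F d, IsMaximalPath P ∧ ∀ f ∈ A, ∃ i, (P i).pt = f}
  lower' := by
    rintro A A' h ⟨P, hP, hA⟩
    exact ⟨P, hP, fun f hf => hA f (h hf)⟩

instance [Finite F] : Finite (Module.Dual F (Fin d → F)) := DFunLike.finite _

/-- The flag resolution: the cellular free complex supported on the flag complex, each covector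
having itself as its partial function label. -/
def flagResolution (k : Type v) [Field k] [Finite F] :
    GradedFreeComplex k ((Fin d → F) × F) :=
  SimplicialCplx.cellularComplex k (flagComplex F d)
    fun f => coGraph (fun x => Part.some (f x) : (Fin d → F) →. F)

end Linfun

/-- `U_p(n) = ∏_{j=0}^{n-1} (p^{n-j} - 1)`. -/
def flagCount (p n : ℕ) : ℕ := ∏ j ∈ Finset.range n, (p ^ (n - j) - 1)

end

/-! Paths can be forgotten: a finite set `A` of functionals is a face of the flag complex exactly
when every `f ∈ A` is the least element of the affine span of the members of `A` that are at least
`f` (`mem_flagComplex_iff`). Two facts about such sets carry everything. The least element of an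
affine subspace `V` can be added to any face inside `V` (`IsFlagFace.insert_isLeast`). Faces are
affinely independent, since each vertex is strictly below the later ones and so outside their span
(`IsFlagFace.affineIndependent`).

The label of `A` vanishes at `(a, b)` exactly when all members of `A` take the value `b` at `a`.
Hence the vertices with label at most `α` form an affine subspace, and if it is nonempty the faces
below `α` form a cone over its least element. The cone gives a contracting homotopy over any field,
hence exactness (`ker_bdry_eq_range`). Deleting a vertex strictly enlarges the set of common values,
because the vertex is not in the affine span of the rest (`faceLabel_erase_ne`); this is minimality.

Betti numbers do not depend on the minimal resolution (`IsMinimalResolution.bettiNumber_eq`), so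
they count faces with a given label. The common part of a face with `i + 1` vertices is a linear
functional on a subspace of codimension `i`. Conversely, the faces with `i + 1` vertices and label
`Γ ℓ` are those contained in the `i`-dimensional space of extensions of `ℓ`. Such a face spans that
space, so it contains its least point, and the rest spans a unique hyperplane missing that point.
The `p ^ i - 1` choices of hyperplane give the product by induction (`card_isFlagFace`). -/

noncomputable section

/-! ### Affine hyperplanes avoiding a point -/

section AvoidingHyperplane

variable {F : Type*} {E : Type*} [Field F] [AddCommGroup E] [Module F E]

/-- The affine hyperplane `{x | φ (x - p) = 1}` of `V`. -/
def avoidingHyperplane (V : AffineSubspace F E) (p : E) (φ : Module.Dual F V.direction) :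
    AffineSubspace F E where
  carrier := {x | ∃ h : x - p ∈ V.direction, φ ⟨x - p, h⟩ = 1}
  smul_vsub_vadd_mem' := by
    rintro c x y z ⟨hx, hx1⟩ ⟨hy, hy1⟩ ⟨hz, hz1⟩
    have e : (c • (x -ᵥ y) +ᵥ z) - p = c • ((x - p) - (y - p)) + (z - p) := by
      simp only [vsub_eq_sub, vadd_eq_add]; abel_nf
    have hm : c • ((x - p) - (y - p)) + (z - p) ∈ V.direction :=
      add_mem (Submodule.smul_mem _ _ (sub_mem hx hy)) hz
    refine ⟨by rw [e]; exact hm, ?_⟩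
    have : (⟨(c • (x -ᵥ y) +ᵥ z) - p, by rw [e]; exact hm⟩ : V.direction) =
        c • (⟨x - p, hx⟩ - ⟨y - p, hy⟩) + ⟨z - p, hz⟩ := Subtype.ext e
    rw [this]
    simp [hx1, hy1, hz1]

variable {V : AffineSubspace F E} {p : E}

theorem avoidingHyperplane_le (hp : p ∈ V) (φ : Module.Dual F V.direction) :
    avoidingHyperplane V p φ ≤ V := by
  rintro x ⟨hx, -⟩
  simpa using AffineSubspace.vadd_mem_of_mem_direction hx hp

theorem notMem_avoidingHyperplane (φ : Module.Dual F V.direction) :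
    p ∉ avoidingHyperplane V p φ := by
  rintro ⟨h, h1⟩
  have : (⟨p - p, h⟩ : V.direction) = 0 := Subtype.ext (sub_self p)
  rw [this, map_zero] at h1
  exact zero_ne_one h1

theorem exists_dual_apply_eq_one {W : Type*} [AddCommGroup W] [Module F W]
    {φ : Module.Dual F W} (hφ : φ ≠ 0) : ∃ w, φ w = 1 := by
  obtain ⟨w, hw⟩ : ∃ w, φ w ≠ 0 := by
    by_contra! h; exact hφ (LinearMap.ext h)
  exact ⟨(φ w)⁻¹ • w, by simp [hw]⟩

theorem add_mem_avoidingHyperplane {φ : Module.Dual F V.direction} {w : V.direction} :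
    (w : E) + p ∈ avoidingHyperplane V p φ ↔ φ w = 1 := by
  have e : (w : E) + p - p = w := add_sub_cancel_right _ _
  constructor
  · rintro ⟨h, h1⟩
    rw [← h1]; congr 1; exact Subtype.ext e.symm
  · intro h
    refine ⟨by rw [e]; exact w.2, ?_⟩
    rw [← h]; congr 1; exact Subtype.ext e

theorem avoidingHyperplane_nonempty {φ : Module.Dual F V.direction} (hφ : φ ≠ 0) :
    (avoidingHyperplane V p φ : Set E).Nonempty := by
  obtain ⟨w, hw⟩ := exists_dual_apply_eq_one hφ
  exact ⟨w + p, add_mem_avoidingHyperplane.2 hw⟩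

/-- A nonzero functional is recovered from its level set at `1`: translating a point of the level
set detects the kernel, and off the kernel `w` rescales into the level set by `(φ w)⁻¹`. -/
theorem avoidingHyperplane_injective {φ ψ : Module.Dual F V.direction} (hφ : φ ≠ 0)
    (h : avoidingHyperplane V p φ = avoidingHyperplane V p ψ) : φ = ψ := by
  have key : ∀ w, φ w = 1 ↔ ψ w = 1 := fun w => by
    rw [← add_mem_avoidingHyperplane (p := p), h, add_mem_avoidingHyperplane]
  obtain ⟨u, hu⟩ := exists_dual_apply_eq_one hφ
  ext w
  by_cases hw : φ w = 0
  · have h1 := (key (u + w)).1 (by simp [hu, hw])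
    rw [map_add, (key u).1 hu, add_eq_left] at h1
    rw [hw, h1]
  · have h1 := (key ((φ w)⁻¹ • w)).1 (by simp [hw])
    rw [map_smul, smul_eq_mul, inv_mul_eq_one₀ hw] at h1
    exact h1

theorem finrank_direction_avoidingHyperplane [Module.Finite F E]
    {φ : Module.Dual F V.direction} (hφ : φ ≠ 0) :
    Module.finrank F (avoidingHyperplane V p φ).direction + 1 =
      Module.finrank F V.direction := by
  have : (avoidingHyperplane V p φ).direction =
      (LinearMap.ker φ).map V.direction.subtype := by
    obtain ⟨u, hu⟩ := exists_dual_apply_eq_one hφ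
    have hu' := (add_mem_avoidingHyperplane (p := p)).2 hu
    ext x
    rw [AffineSubspace.mem_direction_iff_eq_vsub_right hu']
    constructor
    · rintro ⟨y, ⟨hy, hy1⟩, rfl⟩
      refine ⟨⟨y - p, hy⟩ - u, ?_, ?_⟩
      · simp [hy1, hu]
      · simp only [map_sub, Submodule.subtype_apply, vsub_eq_sub]; abel
    · rintro ⟨w, hw, rfl⟩
      have hw0 : φ w = 0 := hw
      refine ⟨((w + u : V.direction) : E) + p,
        add_mem_avoidingHyperplane.2 (by rw [map_add, hw0, hu, zero_add]), ?_⟩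
      simp
  rw [this, LinearEquiv.finrank_eq
    (Submodule.equivSubtypeMap V.direction (LinearMap.ker φ)).symm]
  exact Module.Dual.finrank_ker_add_one_of_ne_zero hφ

/-- For `q ∈ W`, the vector `q - p` is not in the direction of `W`, so some functional kills that
direction and is `1` on `q - p`. Positive dimension matters only for empty `W`, where any nonzero
functional will do. -/
theorem exists_le_avoidingHyperplane {W : AffineSubspace F E} (hW : W ≤ V) (hp : p ∈ V)
    (hpW : p ∉ W) (hV : 0 < Module.finrank F V.direction) :
    ∃ φ : Module.Dual F V.direction, φ ≠ 0 ∧ W ≤ avoidingHyperplane V p φ := by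
  rcases (W : Set E).eq_empty_or_nonempty with h | ⟨q, hq⟩
  · have : Nontrivial V.direction := Module.nontrivial_of_finrank_pos hV
    obtain ⟨φ, hφ⟩ := exists_ne (0 : Module.Dual F V.direction)
    refine ⟨φ, hφ, fun x hx => ?_⟩
    have : x ∈ (W : Set E) := hx
    simp [h] at this
  · have hqp : q - p ∈ V.direction := AffineSubspace.vsub_mem_direction (hW hq) hp
    have hn : (⟨q - p, hqp⟩ : V.direction) ∉ W.direction.comap V.direction.subtype := by
      intro h
      have h2 : q - p ∈ W.direction := h
      have := AffineSubspace.vadd_mem_of_mem_direction (neg_mem h2) hq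
      simp at this
      exact hpW this
    obtain ⟨f, hf, hf2⟩ := Submodule.exists_le_ker_of_notMem hn
    refine ⟨(f ⟨q - p, hqp⟩)⁻¹ • f, smul_ne_zero (inv_ne_zero hf) (fun h => hf (by simp [h])), ?_⟩
    intro x hx
    have hxp : x - p ∈ V.direction := AffineSubspace.vsub_mem_direction (hW hx) hp
    refine ⟨hxp, ?_⟩
    have hxq : x - q ∈ W.direction := AffineSubspace.vsub_mem_direction hx hq
    have h0 : f (⟨x - p, hxp⟩ - ⟨q - p, hqp⟩) = 0 := by
      apply hf2
      change (x - p) - (q - p) ∈ W.direction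
      simpa using hxq
    rw [map_sub, sub_eq_zero] at h0
    rw [LinearMap.smul_apply, h0, smul_eq_mul, inv_mul_cancel₀ hf]

end AvoidingHyperplane

/-! ### Flag faces -/

section FlagFace

theorem exists_isLeast {α : Type*} [LinearOrder α] [Finite α] {s : Set α}
    (hs : s.Nonempty) : ∃ p, IsLeast s p := by
  obtain ⟨p, hp, h⟩ := Set.exists_min_image s id s.toFinite hs
  exact ⟨p, hp, h⟩

variable (F : Type*) {E : Type*} [Field F] [AddCommGroup E] [Module F E] [LinearOrder E]

/-- Each `f ∈ A` is the least element of the affine span of the members of `A` from `f` on. -/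
def IsFlagFace (A : Finset E) : Prop :=
  ∀ f ∈ A, ∀ g ∈ affineSpan F {h | h ∈ A ∧ f ≤ h}, f ≤ g

variable {F}

theorem IsFlagFace.subset {A B : Finset E} (hA : IsFlagFace F A) (h : B ⊆ A) :
    IsFlagFace F B := fun f hf g hg =>
  hA f (h hf) g (affineSpan_mono F (s₂ := {x | x ∈ A ∧ f ≤ x})
    (fun _ hx => ⟨h hx.1, hx.2⟩) hg)

theorem isFlagFace_empty : IsFlagFace F (∅ : Finset E) := by simp [IsFlagFace]

/-- The tail starting at `p` stays inside `V`, where `p` is least; for any other `f`, the point `p`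
is strictly below `f`, so the tail starting at `f` gains nothing. -/
theorem IsFlagFace.insert_isLeast {A : Finset E} (hA : IsFlagFace F A) {V : AffineSubspace F E} {p : E}
    (hp : IsLeast (V : Set E) p) (hAV : (A : Set E) ⊆ V) : IsFlagFace F (insert p A) := by
  intro f hf g hg
  by_cases hfp : f = p
  · subst hfp
    refine hp.2 (?_ : g ∈ V)
    refine affineSpan_le.2 ?_ hg
    rintro x ⟨hx, -⟩
    rcases Finset.mem_insert.1 hx with rfl | hx
    exacts [hp.1, hAV hx]
  · have hfA := Finset.mem_of_mem_insert_of_ne hf hfp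
    refine hA f hfA g (affineSpan_mono F ?_ hg)
    rintro x ⟨hx, hfx⟩
    refine ⟨Finset.mem_of_mem_insert_of_ne hx ?_, hfx⟩
    rintro rfl
    exact hfp (le_antisymm hfx (hp.2 (hAV hfA)))

theorem IsFlagFace.le_of_mem_affineSpan {A : Finset E} (hA : IsFlagFace F A) {p : E} (hp : p ∈ A)
    (hmin : ∀ x ∈ A, p ≤ x) {g : E} (hg : g ∈ affineSpan F (A : Set E)) : p ≤ g :=
  hA p hp g (affineSpan_mono F (s₂ := {x | x ∈ A ∧ p ≤ x}) (fun x hx => ⟨hx, hmin x hx⟩) hg)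

/-- The smallest vertex of a flag face is the minimum of its whole affine span, so nothing below all
vertices lies in the span. -/
theorem IsFlagFace.notMem_affineSpan {A : Finset E} (hA : IsFlagFace F A) {p : E}
    (hp : ∀ x ∈ A, p < x) : p ∉ affineSpan F (A : Set E) := by
  intro h
  have hne : A.Nonempty := by
    have := (affineSpan_nonempty F).1 ⟨p, h⟩
    simpa using this
  exact absurd (hp _ (A.min'_mem hne)) (not_lt.2 (hA.le_of_mem_affineSpan (A.min'_mem hne)
    (fun x hx => A.min'_le x hx) h))

theorem IsFlagFace.affineIndependent {A : Finset E} (hA : IsFlagFace F A) :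
    AffineIndependent F ((↑) : A → E) := by
  induction A using Finset.induction_on_min with
  | empty => exact affineIndependent_of_subsingleton F _
  | insert a s has ih =>
    have hs := hA.subset (Finset.subset_insert a s)
    let i : (insert a s : Finset E) := ⟨a, Finset.mem_insert_self a s⟩
    refine AffineIndependent.affineIndependent_of_notMem_span (i := i) ?_ ?_
    · let e : {y : (insert a s : Finset E) // y ≠ i} ↪ s :=
        ⟨fun y => ⟨y.1.1, Finset.mem_of_mem_insert_of_ne y.1.2 fun h => y.2 (Subtype.ext h)⟩,
          fun x y h => Subtype.ext (Subtype.ext (congrArg (fun z : s => z.1) h))⟩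
      exact (ih hs).comp_embedding e
    · intro h
      refine hs.notMem_affineSpan has (affineSpan_mono F ?_ h)
      rintro _ ⟨y, hy, rfl⟩
      exact Finset.mem_of_mem_insert_of_ne y.2 fun h => hy (Subtype.ext h)

theorem IsFlagFace.notMem_affineSpan_erase {A : Finset E} (hA : IsFlagFace F A) {v : E}
    (hv : v ∈ A) : v ∉ affineSpan F (A.erase v : Set E) := by
  have := hA.affineIndependent.notMem_affineSpan_sdiff ⟨v, hv⟩ Set.univ
  intro h
  apply this
  refine affineSpan_mono F ?_ h
  intro x hx
  have hx' := Finset.mem_erase.1 hx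
  exact ⟨⟨x, hx'.2⟩, ⟨trivial, fun h => hx'.1 (congrArg Subtype.val h)⟩, rfl⟩

theorem IsFlagFace.affineSpan_eq [Module.Finite F E] {A : Finset E} (hA : IsFlagFace F A)
    {V : AffineSubspace F E} (hAV : (A : Set E) ⊆ V)
    (hc : A.card = Module.finrank F V.direction + 1) : affineSpan F (A : Set E) = V := by
  have := hA.affineIndependent.affineSpan_eq_of_le_of_card_eq_finrank_add_one (sp := V)
    (affineSpan_le.2 (by simpa using hAV)) (by simpa using hc)
  simpa using this

theorem IsFlagFace.finrank_vectorSpan {A : Finset E} (hA : IsFlagFace F A) {i : ℕ}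
    (hc : A.card = i + 1) : Module.finrank F (vectorSpan F (A : Set E)) = i := by
  have e : (A : Set E) = Set.range ((↑) : A → E) := by simp
  exact (congrArg (fun s => Module.finrank F (vectorSpan F s)) e).trans
    (hA.affineIndependent.finrank_vectorSpan (n := i) (by simpa using hc))

/-- The number of flag faces with `n + 1` vertices in an affine subspace of dimension `n`. -/
theorem card_isFlagFace [Finite F] [Finite E] (n : ℕ) (V : AffineSubspace F E)
    (hV : (V : Set E).Nonempty) (hn : Module.finrank F V.direction = n) :
    Nat.card {A : Finset E // IsFlagFace F A ∧ (A : Set E) ⊆ V ∧ A.card = n + 1} =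
      flagCount (Nat.card F) n := by
  have : Module.Finite F E := Module.Finite.of_finite
  -- A flag face with one more vertex than the dimension spans `W`, so its smallest vertex is the
  -- least element of `W`.
  have hmin : ∀ {A : Finset E} {W : AffineSubspace F E} {q : E}, IsLeast (W : Set E) q →
      IsFlagFace F A → (A : Set E) ⊆ W → A.card = Module.finrank F W.direction + 1 → q ∈ A := by
    intro A W q hq hA hAW hc
    have hne : A.Nonempty := by rw [← Finset.card_pos]; omega
    have hsp := hA.affineSpan_eq hAW hc
    have h1 : A.min' hne ≤ q := hA.le_of_mem_affineSpan (A.min'_mem hne)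
      (fun x hx => A.min'_le x hx) (hsp ▸ hq.1)
    have h2 : q ≤ A.min' hne := hq.2 (hAW (A.min'_mem hne))
    rw [le_antisymm h2 h1]; exact A.min'_mem hne
  obtain ⟨p, hp⟩ := exists_isLeast hV
  induction n generalizing V p with
  | zero =>
    rw [flagCount, Finset.prod_range_zero, Nat.card_eq_one_iff_unique]
    refine ⟨⟨?_⟩, ⟨⟨{p}, ?_, by simpa using hp.1, by simp⟩⟩⟩
    · rintro ⟨A, hA, hAV, hc⟩ ⟨B, hB, hBV, hc'⟩
      have h1 := hmin hp hA hAV (by omega)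
      have h2 := hmin hp hB hBV (by omega)
      obtain ⟨a, rfl⟩ := Finset.card_eq_one.1 hc
      obtain ⟨b, rfl⟩ := Finset.card_eq_one.1 hc'
      simp only [Finset.mem_singleton] at h1 h2
      simp [← h1, ← h2]
    · have := isFlagFace_empty (F := F).insert_isLeast hp (by simp)
      simpa using this
  | succ n ih =>
    have hIH : ∀ φ : {φ : Module.Dual F V.direction // φ ≠ 0},
        Nat.card {B : Finset E // IsFlagFace F B ∧ (B : Set E) ⊆ avoidingHyperplane V p φ.1 ∧
          B.card = n + 1} = flagCount (Nat.card F) n := by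
      intro φ
      have hne := avoidingHyperplane_nonempty (p := p) φ.2
      obtain ⟨q, hq⟩ := exists_isLeast hne
      have := finrank_direction_avoidingHyperplane (p := p) φ.2
      exact ih _ hne (by omega) q hq
    have hlt : ∀ (φ : Module.Dual F V.direction) (B : Finset E),
        (B : Set E) ⊆ avoidingHyperplane V p φ → p ∉ B := fun φ B hB hpB =>
      notMem_avoidingHyperplane φ (hB hpB)
    -- A full-size face of `V` is `p` together with a full-size face of a hyperplane missing `p`;
    -- such hyperplanes are indexed by the nonzero functionals on the direction of `V`.
    let e : (Σ φ : {φ : Module.Dual F V.direction // φ ≠ 0},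
        {B : Finset E // IsFlagFace F B ∧ (B : Set E) ⊆ avoidingHyperplane V p φ.1 ∧
          B.card = n + 1}) →
        {A : Finset E // IsFlagFace F A ∧ (A : Set E) ⊆ V ∧ A.card = n + 1 + 1} := fun x =>
      ⟨insert p x.2.1, x.2.2.1.insert_isLeast hp
          (x.2.2.2.1.trans (avoidingHyperplane_le hp.1 _)), by
        rw [Finset.coe_insert]
        exact Set.insert_subset hp.1 (x.2.2.2.1.trans (avoidingHyperplane_le hp.1 _)), by
        rw [Finset.card_insert_of_notMem (hlt _ _ x.2.2.2.1), x.2.2.2.2]⟩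
    have he : Function.Bijective e := by
      constructor
      · rintro ⟨φ, B, hB, hBφ, hc⟩ ⟨ψ, C, hC, hCψ, hc'⟩ h
        have h1 : insert p B = insert p C := congrArg Subtype.val h
        have h2 : B = C := by
          rw [← Finset.erase_insert (hlt _ _ hBφ), h1, Finset.erase_insert (hlt _ _ hCψ)]
        subst h2
        have r1 := finrank_direction_avoidingHyperplane (p := p) φ.2
        have r2 := finrank_direction_avoidingHyperplane (p := p) ψ.2
        -- `B` spans both hyperplanes, so they coincide.
        have h3 := hB.affineSpan_eq hBφ (by omega)
        have h4 := hB.affineSpan_eq hCψ (by omega)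
        have h5 : φ = ψ := Subtype.ext (avoidingHyperplane_injective φ.2 (h3.symm.trans h4))
        subst h5
        rfl
      · rintro ⟨A, hA, hAV, hc⟩
        have hpA := hmin hp hA hAV (by omega)
        obtain ⟨φ, hφ, hφ2⟩ := exists_le_avoidingHyperplane (p := p)
          (W := affineSpan F (A.erase p : Set E))
          (affineSpan_le.2 (fun x hx => hAV (Finset.mem_of_mem_erase hx))) hp.1
          (hA.notMem_affineSpan_erase hpA) (by omega)
        refine ⟨⟨⟨φ, hφ⟩, ⟨A.erase p, hA.subset (Finset.erase_subset _ _),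
          affineSpan_le.1 hφ2, by rw [Finset.card_erase_of_mem hpA, hc]; rfl⟩⟩, ?_⟩
        exact Subtype.ext (Finset.insert_erase hpA)
    have hfin : Finite (Module.Dual F V.direction) := DFunLike.finite _
    rw [← Nat.card_congr (Equiv.ofBijective e he)]
    have := Fintype.ofFinite {φ : Module.Dual F V.direction // φ ≠ 0}
    rw [Nat.card_sigma, Finset.sum_congr rfl fun φ _ => hIH φ, Finset.sum_const, smul_eq_mul,
      Finset.card_univ, ← Nat.card_eq_fintype_card]
    have hcard : Nat.card {φ : Module.Dual F V.direction // φ ≠ 0} = Nat.card F ^ (n + 1) - 1 := by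
      have := Fintype.ofFinite F
      have := Fintype.ofFinite (Module.Dual F V.direction)
      classical
      rw [Nat.card_eq_fintype_card, Fintype.card_subtype_compl, Fintype.card_subtype_eq,
        Module.card_eq_pow_finrank (K := F), Subspace.dual_finrank_eq, hn,
        Nat.card_eq_fintype_card]
    rw [hcard, flagCount, flagCount, Finset.prod_range_succ', mul_comm]
    simp

end FlagFace

/-! ### Faces of the flag complex -/

section FlagComplex

variable {F : Type u} [Field F] {d : ℕ}

theorem finrank_direction_top_dual :
    Module.finrank F (⊤ : AffineSubspace F (Module.Dual F (Fin d → F))).direction = d := by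
  rw [AffineSubspace.direction_top, finrank_top, Subspace.dual_finrank_eq, Module.finrank_fin_fun]

variable [LinearOrder (Module.Dual F (Fin d → F))]

theorem IsMaximalPath.antitone {P : Fin (d + 1) → FlagNode F d} (hP : IsMaximalPath P) :
    Antitone fun i => (P i).space :=
  Fin.antitone_iff_succ_le.2 fun i => (hP.2 i).1

theorem IsMaximalPath.pt_notMem {P : Fin (d + 1) → FlagNode F d} (hP : IsMaximalPath P)
    {i j : Fin (d + 1)} (hij : i < j) : (P i).pt ∉ (P j).space := by
  have hi : i ≠ Fin.last d := (hij.trans_le (Fin.le_last j)).ne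
  obtain ⟨i, rfl⟩ := Fin.exists_castSucc_eq.2 hi
  exact fun h => (hP.2 i).2.2 (hP.antitone (Fin.castSucc_lt_iff_succ_le.1 hij) h)

theorem IsMaximalPath.pt_injective {P : Fin (d + 1) → FlagNode F d} (hP : IsMaximalPath P) :
    Function.Injective fun i => (P i).pt := by
  intro i j h
  simp only at h
  rcases lt_trichotomy i j with hij | hij | hij
  · exact absurd (h ▸ (P j).isLeast.1) (hP.pt_notMem hij)
  · exact hij
  · exact absurd (h ▸ (P i).isLeast.1) (hP.pt_notMem hij)

/-- Later points of the path lie in `(P i).space`. An earlier point is at most `(P i).pt`, so it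
belongs to the tail only if equal to it. -/
theorem IsMaximalPath.isFlagFace {P : Fin (d + 1) → FlagNode F d} (hP : IsMaximalPath P)
    {A : Finset (Module.Dual F (Fin d → F))} (hA : ∀ f ∈ A, ∃ i, (P i).pt = f) :
    IsFlagFace F A := by
  intro f hf g hg
  obtain ⟨i, rfl⟩ := hA f hf
  refine (P i).isLeast.2 (?_ : g ∈ (P i).space)
  refine affineSpan_le.2 ?_ hg
  rintro h ⟨hh, hle⟩
  obtain ⟨j, rfl⟩ := hA h hh
  rcases le_or_gt i j with hij | hij
  · exact hP.antitone hij (P j).isLeast.1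
  · have := (P j).isLeast.2 (hP.antitone hij.le (P i).isLeast.1)
    rw [← le_antisymm hle this]
    exact (P i).isLeast.1

/-- Greedy descent: the remaining vertices lie strictly above `n.pt`, so their span misses it and
fits into a hyperplane of `n.space` avoiding `n.pt`; recurse there. The point `n.pt` need not be in
`A`, so non-maximal faces also get a path. -/
theorem exists_path_of_isFlagFace [Finite F] (r : ℕ) (n : FlagNode F d)
    (hr : Module.finrank F n.space.direction = r) {A : Finset (Module.Dual F (Fin d → F))}
    (hA : IsFlagFace F A) (hAn : (A : Set (Module.Dual F (Fin d → F))) ⊆ n.space) :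
    ∃ P : Fin (r + 1) → FlagNode F d, P 0 = n ∧
      (∀ i : Fin r, (P i.succ).IsChild (P i.castSucc)) ∧ ∀ f ∈ A, ∃ i, (P i).pt = f := by
  induction r generalizing n A with
  | zero =>
    refine ⟨fun _ => n, rfl, fun i => i.elim0, fun f hf => ⟨0, ?_⟩⟩
    rw [Submodule.finrank_eq_zero] at hr
    have := AffineSubspace.vsub_mem_direction (hAn hf) n.isLeast.1
    rw [hr, Submodule.mem_bot, vsub_eq_sub, sub_eq_zero] at this
    exact this.symm
  | succ r ih =>
    have hB : IsFlagFace F (A.erase n.pt) := hA.subset (Finset.erase_subset _ _)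
    obtain ⟨φ, hφ, hφ2⟩ := exists_le_avoidingHyperplane (p := n.pt)
      (W := affineSpan F (A.erase n.pt : Set (Module.Dual F (Fin d → F))))
      (affineSpan_le.2 (fun x hx => hAn (Finset.mem_of_mem_erase hx))) n.isLeast.1
      (hB.notMem_affineSpan fun x hx => lt_of_le_of_ne
        (n.isLeast.2 (hAn (Finset.mem_of_mem_erase hx))) (Finset.ne_of_mem_erase hx).symm)
      (by omega)
    obtain ⟨q, hq⟩ := exists_isLeast (avoidingHyperplane_nonempty (p := n.pt) hφ)
    have hrk := finrank_direction_avoidingHyperplane (p := n.pt) hφ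
    obtain ⟨P, hP0, hP, hPA⟩ := ih ⟨q, _, hq⟩ (by simp only; omega) hB (affineSpan_le.1 hφ2)
    refine ⟨Fin.cons n P, rfl, fun i => ?_, fun f hf => ?_⟩
    · refine Fin.cases ?_ (fun j => ?_) i
      · simp only [Fin.cons_succ, Fin.castSucc_zero, Fin.cons_zero, hP0]
        exact ⟨avoidingHyperplane_le n.isLeast.1 φ, hrk, notMem_avoidingHyperplane φ⟩
      · simp only [Fin.cons_succ, ← Fin.succ_castSucc]
        exact hP j
    · by_cases h : f = n.pt
      · exact ⟨0, h.symm⟩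
      · obtain ⟨i, hi⟩ := hPA f (Finset.mem_erase.2 ⟨h, hf⟩)
        exact ⟨i.succ, by simpa using hi⟩

theorem mem_flagComplex_iff [Finite F] {A : Finset (Module.Dual F (Fin d → F))} :
    A ∈ flagComplex F d ↔ IsFlagFace F A := by
  constructor
  · rintro ⟨P, hP, hA⟩
    exact hP.isFlagFace hA
  · intro hA
    obtain ⟨p, hp⟩ := exists_isLeast
      (s := ((⊤ : AffineSubspace F (Module.Dual F (Fin d → F))) : Set (Module.Dual F (Fin d → F))))
      ⟨0, AffineSubspace.mem_top F _ _⟩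
    obtain ⟨P, h0, hP, hPA⟩ := exists_path_of_isFlagFace d ⟨p, ⊤, hp⟩
      finrank_direction_top_dual hA (fun _ _ => AffineSubspace.mem_top F _ _)
    exact ⟨P, ⟨by rw [h0], hP⟩, hPA⟩

theorem hasDim_flagComplex [Finite F] : (flagComplex F d).HasDim d := by
  constructor
  · obtain ⟨P, hP, -⟩ := (mem_flagComplex_iff (F := F) (d := d)).2 isFlagFace_empty
    refine ⟨Finset.univ.image fun i => (P i).pt, ⟨P, hP, by simp⟩, ?_⟩
    rw [Finset.card_image_of_injective _ hP.pt_injective]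
    simp
  · rintro _ ⟨A, ⟨P, hP, hA⟩, rfl⟩
    have h1 : A ⊆ Finset.univ.image fun i => (P i).pt := fun f hf => by
      obtain ⟨i, hi⟩ := hA f hf
      exact Finset.mem_image.2 ⟨i, Finset.mem_univ i, hi⟩
    have h2 := (Finset.card_le_card h1).trans Finset.card_image_le
    rw [Finset.card_univ, Fintype.card_fin] at h2
    omega

end FlagComplex

/-! ### Homogeneous elements and maps of graded free modules -/

section Homogeneous

variable {k : Type v} [Field k] {σ : Type u} {B C : Type*}

/-- The element `y` of the graded free module with basis degrees `deg` has degree `a`. -/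
def IsHomogeneousOfDegree (deg : B → (σ →₀ ℕ)) (a : σ →₀ ℕ) (y : B →₀ MvPolynomial σ k) : Prop :=
  ∀ c m, coeff m (y c) ≠ 0 → m + deg c = a

/-- The linear map `L` of graded free modules preserves degrees. -/
def IsHomogeneousMap (degB : B → (σ →₀ ℕ)) (degC : C → (σ →₀ ℕ))
    (L : (B →₀ MvPolynomial σ k) →ₗ[MvPolynomial σ k] (C →₀ MvPolynomial σ k)) : Prop :=
  ∀ b, IsHomogeneousOfDegree degC (degB b) (L (Finsupp.single b 1))

open Classical in
/-- The projection of a graded free module to its component of degree `a`. -/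
def degreeComponent (deg : B → (σ →₀ ℕ)) (a : σ →₀ ℕ) :
    (B →₀ MvPolynomial σ k) →ₗ[k] (B →₀ MvPolynomial σ k) where
  toFun y := Finsupp.onFinset y.support
    (fun c => if deg c ≤ a then monomial (a - deg c) (coeff (a - deg c) (y c)) else 0) (by
      intro c hc
      rw [Finsupp.mem_support_iff]
      intro h
      simp [h] at hc)
  map_add' x y := by
    ext1 c
    simp only [Finsupp.onFinset_apply, Finsupp.add_apply, coeff_add, map_add]
    split_ifs <;> simp
  map_smul' r x := by
    ext1 c
    simp only [Finsupp.onFinset_apply, Finsupp.smul_apply, coeff_smul, RingHom.id_apply, map_smul]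
    split_ifs <;> simp

open Classical in
theorem coeff_degreeComponent (deg : B → (σ →₀ ℕ)) (a : σ →₀ ℕ) (y : B →₀ MvPolynomial σ k) (c : B)
    (m : σ →₀ ℕ) :
    coeff m (degreeComponent deg a y c) = if m + deg c = a then coeff m (y c) else 0 := by
  simp only [degreeComponent, LinearMap.coe_mk, AddHom.coe_mk, Finsupp.onFinset_apply]
  by_cases h : m + deg c = a
  · subst h
    simp
  · rw [if_neg h]
    split_ifs with h2
    · rw [coeff_monomial, if_neg]
      rintro rfl
      exact h (tsub_add_cancel_of_le h2)
    · simp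

theorem isHomogeneousOfDegree_degreeComponent (deg : B → (σ →₀ ℕ)) (a : σ →₀ ℕ)
    (y : B →₀ MvPolynomial σ k) : IsHomogeneousOfDegree deg a (degreeComponent deg a y) := by
  classical
  intro c m h
  rw [coeff_degreeComponent] at h
  by_contra h2
  exact h (if_neg h2)

open Classical in
theorem IsHomogeneousOfDegree.degreeComponent_eq {deg : B → (σ →₀ ℕ)} {a : σ →₀ ℕ}
    {y : B →₀ MvPolynomial σ k} (h : IsHomogeneousOfDegree deg a y) (b : σ →₀ ℕ) :
    degreeComponent deg b y = if a = b then y else 0 := by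
  ext c m
  rw [coeff_degreeComponent]
  by_cases h0 : coeff m (y c) = 0
  · split_ifs <;> simp [h0]
  · rw [h c m h0]
    split_ifs <;> simp

theorem isHomogeneousOfDegree_single (deg : B → (σ →₀ ℕ)) (b : B) (m : σ →₀ ℕ) (r : k) :
    IsHomogeneousOfDegree deg (m + deg b) (Finsupp.single b (monomial m r)) := by
  classical
  intro c n h
  rw [Finsupp.single_apply] at h
  split_ifs at h with hbc
  · rw [coeff_monomial] at h
    split_ifs at h with hm
    · rw [hm, hbc]
    · exact absurd rfl h
  · simp at h

theorem IsHomogeneousOfDegree.monomial_smul {deg : B → (σ →₀ ℕ)} {a : σ →₀ ℕ}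
    {y : B →₀ MvPolynomial σ k} (h : IsHomogeneousOfDegree deg a y) (m : σ →₀ ℕ) (r : k) :
    IsHomogeneousOfDegree deg (m + a) (monomial m r • y) := by
  classical
  intro c n hn
  rw [Finsupp.smul_apply, smul_eq_mul, coeff_monomial_mul'] at hn
  split_ifs at hn with hmn
  · rw [← h c _ (right_ne_zero_of_mul hn), ← add_assoc, add_tsub_cancel_of_le hmn]
  · exact absurd rfl hn

variable {degB : B → (σ →₀ ℕ)} {degC : C → (σ →₀ ℕ)}
  {L : (B →₀ MvPolynomial σ k) →ₗ[MvPolynomial σ k] (C →₀ MvPolynomial σ k)}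

/-- Both sides are `k`-linear, and on a monomial multiple of a basis element each side either keeps
everything or gives zero. -/
theorem IsHomogeneousMap.degreeComponent_comm (hL : IsHomogeneousMap degB degC L) (a : σ →₀ ℕ)
    (y : B →₀ MvPolynomial σ k) :
    degreeComponent degC a (L y) = L (degreeComponent degB a y) := by
  classical
  suffices h : degreeComponent degC a ∘ₗ L.restrictScalars k =
      L.restrictScalars k ∘ₗ degreeComponent degB a from LinearMap.congr_fun h y
  refine Finsupp.lhom_ext' fun b => MvPolynomial.linearMap_ext fun m => LinearMap.ext_ring ?_
  simp only [LinearMap.comp_apply, Finsupp.lsingle_apply, LinearMap.coe_restrictScalars]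
  have e : (Finsupp.single b (monomial m 1) : B →₀ MvPolynomial σ k) =
      monomial m (1 : k) • Finsupp.single b 1 := by
    rw [Finsupp.smul_single, smul_eq_mul, mul_one]
  rw [(isHomogeneousOfDegree_single degB b m 1).degreeComponent_eq a, e, map_smul,
    ((hL b).monomial_smul m 1).degreeComponent_eq a]
  split_ifs
  · exact (map_smul _ _ _).symm
  · exact (map_zero _).symm

theorem IsHomogeneousMap.map (hL : IsHomogeneousMap degB degC L) {a : σ →₀ ℕ}
    {y : B →₀ MvPolynomial σ k} (hy : IsHomogeneousOfDegree degB a y) :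
    IsHomogeneousOfDegree degC a (L y) := by
  have h := hL.degreeComponent_comm a y
  rw [hy.degreeComponent_eq, if_pos rfl] at h
  rw [← h]
  exact isHomogeneousOfDegree_degreeComponent _ _ _

theorem IsHomogeneousMap.exists_preimage (hL : IsHomogeneousMap degB degC L) {a : σ →₀ ℕ}
    {z : C →₀ MvPolynomial σ k} (hz : IsHomogeneousOfDegree degC a z) (h : z ∈ LinearMap.range L) :
    ∃ y, IsHomogeneousOfDegree degB a y ∧ L y = z := by
  obtain ⟨y, rfl⟩ := h
  refine ⟨degreeComponent degB a y, isHomogeneousOfDegree_degreeComponent _ _ _, ?_⟩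
  rw [← hL.degreeComponent_comm, hz.degreeComponent_eq, if_pos rfl]

theorem IsHomogeneousMap.exists_lift {D : Type*} {degD : D → (σ →₀ ℕ)}
    (hL : IsHomogeneousMap degB degC L)
    {f : (D →₀ MvPolynomial σ k) →ₗ[MvPolynomial σ k] (C →₀ MvPolynomial σ k)}
    (hf : IsHomogeneousMap degD degC f) (h : ∀ x, f x ∈ LinearMap.range L) :
    ∃ φ : (D →₀ MvPolynomial σ k) →ₗ[MvPolynomial σ k] (B →₀ MvPolynomial σ k),
      IsHomogeneousMap degD degB φ ∧ ∀ x, L (φ x) = f x := by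
  choose y hy hy2 using fun b => hL.exists_preimage (hf b) (h _)
  refine ⟨Finsupp.linearCombination _ y, fun b => ?_, fun x => ?_⟩
  · rw [Finsupp.linearCombination_single, one_smul]
    exact hy b
  · refine LinearMap.congr_fun (f := L ∘ₗ Finsupp.linearCombination _ y) (g := f) ?_ x
    refine Finsupp.lhom_ext' fun b => LinearMap.ext_ring ?_
    simp [hy2]

/-- The ungraded counterpart serves for the backward map and the homotopies, whose degrees play no
role. -/
theorem exists_linearMap_lift {R D M N : Type*} [CommRing R] [AddCommGroup M] [Module R M]
    [AddCommGroup N] [Module R N] (g : M →ₗ[R] N) (f : (D →₀ R) →ₗ[R] N)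
    (h : ∀ x, f x ∈ LinearMap.range g) : ∃ l : (D →₀ R) →ₗ[R] M, ∀ x, g (l x) = f x := by
  choose y hy using fun b => h (Finsupp.single b 1)
  refine ⟨Finsupp.linearCombination _ y, fun x => ?_⟩
  refine LinearMap.congr_fun (f := g ∘ₗ Finsupp.linearCombination _ y) (g := f) ?_ x
  refine Finsupp.lhom_ext' fun b => LinearMap.ext_ring ?_
  simp [hy]

end Homogeneous

/-! ### Uniqueness of Betti numbers -/

namespace GradedFreeComplex

variable {k : Type v} [Field k] {σ : Type u} {C C' : GradedFreeComplex k σ}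

theorem isHomogeneousMap_d (C : GradedFreeComplex k σ) (i : ℕ) :
    IsHomogeneousMap (C.deg (i + 1)) (C.deg i) (C.d i) := fun b c m h => C.homogeneous i b c m h

theorem d_d_apply (C : GradedFreeComplex k σ) (i : ℕ) (x : C.basis (i + 1 + 1) →₀ MvPolynomial σ k) :
    C.d i (C.d (i + 1) x) = 0 := LinearMap.congr_fun (C.d_comp_d i) x

/-- A chain map `φ` from `C` to `C'` in homological degree `i`, together with a chain map `ψ` back
and a homotopy `h` from `ψ ∘ φ` to the identity, such that `ψ ∘ φ` is the identity modulo the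
maximal ideal. -/
structure Comparison (C C' : GradedFreeComplex k σ) (i : ℕ) where
  φ : (C.basis i →₀ MvPolynomial σ k) →ₗ[MvPolynomial σ k] (C'.basis i →₀ MvPolynomial σ k)
  ψ : (C'.basis i →₀ MvPolynomial σ k) →ₗ[MvPolynomial σ k] (C.basis i →₀ MvPolynomial σ k)
  h : (C.basis i →₀ MvPolynomial σ k) →ₗ[MvPolynomial σ k]
    (C.basis (i + 1) →₀ MvPolynomial σ k)
  homogeneous : IsHomogeneousMap (C.deg i) (C'.deg i) φ
  φ_mem : ∀ z ∈ LinearMap.range (C.d i), φ z ∈ LinearMap.range (C'.d i)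
  ψ_mem : ∀ z ∈ LinearMap.range (C'.d i), ψ z ∈ LinearMap.range (C.d i)
  homotopy : ∀ z ∈ LinearMap.range (C.d i), C.d i (h z) = ψ (φ z) - z
  sub_mem : ∀ x, ψ (φ x) - x ∈ Ideal.span (Set.range (X : σ → MvPolynomial σ k)) •
    (⊤ : Submodule (MvPolynomial σ k) (C.basis i →₀ MvPolynomial σ k))

/-- The usual comparison argument: `ψ ∘ φ - 1 - h ∘ d` takes values in cycles, hence boundaries, and
lifts to the next homotopy. Then `ψ ∘ φ - 1` is `d ∘ h + h ∘ d`, which is zero modulo the maximal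
ideal because `C` is minimal. -/
theorem Comparison.succ (hmin : C.IsMinimal)
    (hC : ∀ i, LinearMap.ker (C.d i) = LinearMap.range (C.d (i + 1)))
    (hC' : ∀ i, LinearMap.ker (C'.d i) = LinearMap.range (C'.d (i + 1))) {i : ℕ}
    (s : Comparison C C' i) : Nonempty (Comparison C C' (i + 1)) := by
  obtain ⟨φ, hφ, hφ2⟩ := (C'.isHomogeneousMap_d i).exists_lift (f := s.φ ∘ₗ C.d i)
    (degD := C.deg (i + 1)) (fun b => s.homogeneous.map (C.isHomogeneousMap_d i b))
    (fun x => s.φ_mem _ ⟨x, rfl⟩)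
  obtain ⟨ψ, hψ⟩ := exists_linearMap_lift (C.d i) (s.ψ ∘ₗ C'.d i) (fun x => s.ψ_mem _ ⟨x, rfl⟩)
  have hφ3 : ∀ z ∈ LinearMap.range (C.d (i + 1)), φ z ∈ LinearMap.range (C'.d (i + 1)) := by
    rintro _ ⟨y, rfl⟩
    rw [← hC', LinearMap.mem_ker, hφ2, LinearMap.comp_apply, d_d_apply, map_zero]
  have hψ3 : ∀ z ∈ LinearMap.range (C'.d (i + 1)), ψ z ∈ LinearMap.range (C.d (i + 1)) := by
    rintro _ ⟨y, rfl⟩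
    rw [← hC, LinearMap.mem_ker, hψ, LinearMap.comp_apply, d_d_apply, map_zero]
  obtain ⟨h, hh⟩ := exists_linearMap_lift (C.d (i + 1))
    (ψ ∘ₗ φ - LinearMap.id - s.h ∘ₗ C.d i) (fun x => by
      rw [← hC, LinearMap.mem_ker]
      have := s.homotopy (C.d i x) ⟨x, rfl⟩
      simp only [LinearMap.sub_apply, LinearMap.comp_apply, LinearMap.id_apply, map_sub, hψ, hφ2,
        this, sub_self])
  refine ⟨⟨φ, ψ, h, hφ, hφ3, hψ3, ?_, fun x => ?_⟩⟩
  · rintro _ ⟨y, rfl⟩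
    rw [hh]
    simp [d_d_apply]
  · have e : ψ (φ x) - x = C.d (i + 1) (h x) + s.h (C.d i x) := by
      rw [hh]; simp
    rw [e]
    refine add_mem (hmin (i + 1) ⟨_, rfl⟩) ?_
    have h1 : s.h (C.d i x) ∈ Submodule.map s.h
        (Ideal.span (Set.range (X : σ → MvPolynomial σ k)) • ⊤) := ⟨_, hmin i ⟨x, rfl⟩, rfl⟩
    rw [Submodule.map_smul''] at h1
    exact Submodule.smul_mono le_rfl le_top h1

variable {I : Ideal (MvPolynomial σ k)}

/-- The ideal is viewed inside the free module on one generator of degree `0`, so that graded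
lifting applies to augmentations too. -/
theorem isHomogeneousMap_augmentation
    {ε : (C.basis 0 →₀ MvPolynomial σ k) →ₗ[MvPolynomial σ k] I}
    (h : ∀ b, ε (Finsupp.single b 1) ∈ idealPiece I (C.deg 0 b)) :
    IsHomogeneousMap (C.deg 0) (fun _ : Unit => 0)
      (Finsupp.lsingle () ∘ₗ I.subtype ∘ₗ ε) := by
  intro b
  obtain ⟨r, hr⟩ := h b
  have hr : monomial (C.deg 0 b) r = (ε (Finsupp.single b 1) : MvPolynomial σ k) := hr
  simp only [LinearMap.comp_apply, Submodule.subtype_apply, Finsupp.lsingle_apply, ← hr]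
  simpa using isHomogeneousOfDegree_single (fun _ : Unit => 0) () (C.deg 0 b) r

theorem nonempty_comparison (hC : C.IsMinimalResolution I (idealPiece I))
    (hC' : C'.IsResolution I (idealPiece I)) (i : ℕ) : Nonempty (Comparison C C' i) := by
  induction i with
  | succ i ih => exact ih.some.succ hC.2 hC.1.1 hC'.1
  | zero =>
    obtain ⟨⟨-, ε, hε, hker, hdeg⟩, hmin⟩ := hC
    obtain ⟨-, ε', hε', hker', hdeg'⟩ := hC'
    have hinj : Function.Injective ((Finsupp.lsingle () : MvPolynomial σ k →ₗ[MvPolynomial σ k]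
        (Unit →₀ MvPolynomial σ k)) ∘ₗ I.subtype) :=
      (Finsupp.single_injective ()).comp Subtype.val_injective
    obtain ⟨φ, hφ, hφ2⟩ := (isHomogeneousMap_augmentation hdeg').exists_lift
      (isHomogeneousMap_augmentation hdeg) (fun x => by
        obtain ⟨y, hy⟩ := hε' (ε x)
        exact ⟨y, by simp [hy]⟩)
    have hφ3 : ∀ x, ε' (φ x) = ε x := fun x => hinj (hφ2 x)
    obtain ⟨ψ, hψ⟩ := exists_linearMap_lift ε ε' (fun x => hε _)
    obtain ⟨h, hh⟩ := exists_linearMap_lift (C.d 0) (ψ ∘ₗ φ - LinearMap.id) (fun x => by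
      rw [← hker, LinearMap.mem_ker]
      simp [hψ, hφ3])
    refine ⟨⟨φ, ψ, h, hφ, fun z hz => ?_, fun z hz => ?_, fun z _ => hh z, fun x => ?_⟩⟩
    · rw [← hker', LinearMap.mem_ker, hφ3]
      rwa [← hker] at hz
    · rw [← hker, LinearMap.mem_ker, hψ]
      rwa [← hker'] at hz
    · exact hmin 0 ⟨h x, hh x⟩

theorem constantCoeff_apply_eq_zero {B : Type*} {x : B →₀ MvPolynomial σ k}
    (hx : x ∈ Ideal.span (Set.range (X : σ → MvPolynomial σ k)) •
      (⊤ : Submodule (MvPolynomial σ k) (B →₀ MvPolynomial σ k))) (b : B) :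
    constantCoeff (x b) = 0 := by
  refine Submodule.smul_induction_on hx (fun r hr n _ => ?_) (fun x y hx hy => ?_)
  · have : Ideal.span (Set.range (X : σ → MvPolynomial σ k)) ≤ RingHom.ker constantCoeff := by
      rw [Ideal.span_le]
      rintro _ ⟨s, rfl⟩
      simp
    rw [Finsupp.smul_apply, smul_eq_mul, map_mul, (this hr : constantCoeff r = 0), zero_mul]
  · rw [Finsupp.add_apply, map_add, hx, hy, add_zero]

/-- Take constant terms in the degree-`a` blocks: since `ψ ∘ φ` is the identity modulo the maximal
ideal, the block of `φ` has a left inverse. -/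
theorem Comparison.mult_le {i : ℕ} (s : Comparison C C' i) (a : σ →₀ ℕ) :
    C.mult i a ≤ C'.mult i a := by
  classical
  have := C.finite_basis i
  have := C'.finite_basis i
  have := Fintype.ofFinite (C.basis i)
  have := Fintype.ofFinite (C'.basis i)
  let M : Matrix {c : C'.basis i // C'.deg i c = a} {b : C.basis i // C.deg i b = a} k :=
    Matrix.of fun c b => constantCoeff (s.φ (Finsupp.single b.1 1) c.1)
  let N : Matrix {b : C.basis i // C.deg i b = a} {c : C'.basis i // C'.deg i c = a} k :=
    Matrix.of fun b c => constantCoeff (s.ψ (Finsupp.single c.1 1) b.1)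
  have hNM : N * M = 1 := by
    ext b' b
    have h1 := constantCoeff_apply_eq_zero (s.sub_mem (Finsupp.single b.1 1)) b'.1
    have h2 : s.ψ (s.φ (Finsupp.single b.1 1)) = ∑ c : C'.basis i,
        s.φ (Finsupp.single b.1 1) c • s.ψ (Finsupp.single c 1) := by
      conv_lhs => rw [← Finsupp.univ_sum_single (s.φ (Finsupp.single b.1 1)), map_sum]
      refine Finset.sum_congr rfl fun c _ => ?_
      rw [← map_smul, Finsupp.smul_single, smul_eq_mul, mul_one]
    rw [Finsupp.sub_apply, map_sub, sub_eq_zero, h2, Finsupp.finsetSum_apply, map_sum] at h1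
    -- Homogeneity of `φ` makes the constant terms vanish outside degree `a`, so the sum over the
    -- whole basis of `C'` reduces to the block.
    have h3 : (N * M) b' b = ∑ c : C'.basis i,
        constantCoeff ((s.φ (Finsupp.single b.1 1) c • s.ψ (Finsupp.single c 1)) b'.1) := by
      rw [Matrix.mul_apply, ← Finset.sum_filter_of_ne (p := fun c => C'.deg i c = a),
        Finset.sum_subtype (p := fun c => C'.deg i c = a) _ (by simp)]
      · refine Finset.sum_congr rfl fun c _ => ?_
        rw [Finsupp.smul_apply, smul_eq_mul, map_mul, mul_comm]
        rfl
      · intro c _ hc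
        rw [Finsupp.smul_apply, smul_eq_mul, map_mul] at hc
        have := s.homogeneous b.1 c 0 (left_ne_zero_of_mul hc)
        rwa [zero_add, b.2] at this
    rw [h3, h1, Finsupp.single_apply, Matrix.one_apply]
    simp only [Subtype.ext_iff, eq_comm (a := b.1)]
    split_ifs <;> simp
  have hinj : Function.Injective M.mulVecLin := by
    refine Function.LeftInverse.injective (g := N.mulVecLin) fun x => ?_
    simp [hNM]
  have := LinearMap.finrank_le_finrank_of_injective hinj
  rw [Module.finrank_fintype_fun_eq_card, Module.finrank_fintype_fun_eq_card] at this
  rwa [mult, mult, Nat.card_eq_fintype_card, Nat.card_eq_fintype_card]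

theorem IsMinimalResolution.bettiNumber_eq (hC : C.IsMinimalResolution I (idealPiece I)) (i : ℕ)
    (a : σ →₀ ℕ) : bettiNumber (k := k) I (idealPiece I) i a = C.mult i a := by
  have h : ∃ C : GradedFreeComplex k σ, C.IsMinimalResolution (↥I) (idealPiece I) := ⟨C, hC⟩
  rw [bettiNumber, dif_pos h]
  exact le_antisymm ((nonempty_comparison (I := I) h.choose_spec hC.1 i).some.mult_le a)
    ((nonempty_comparison hC h.choose_spec.1 i).some.mult_le a)

end GradedFreeComplex

/-! ### From a resolution of the quotient to one of the ideal -/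

namespace GradedFreeComplex

variable {k : Type v} [Field k] {σ : Type u}

/-- The complex `C` with its term in homological degree `0` removed. -/
def shift (C : GradedFreeComplex k σ) : GradedFreeComplex k σ where
  basis i := C.basis (i + 1)
  finite_basis i := C.finite_basis (i + 1)
  bounded := by
    obtain ⟨l, hl⟩ := C.bounded
    exact ⟨l, fun i hi => hl _ (by omega)⟩
  deg i := C.deg (i + 1)
  d i := C.d (i + 1)
  homogeneous i := C.homogeneous (i + 1)
  d_comp_d i := C.d_comp_d (i + 1)

/-- As `e` is injective, `e ∘ₗ C.d 0` has the same kernel as `C.d 0`, so it is an augmentation of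
the truncated complex onto `I`. -/
theorem isMinimalResolution_shift {C : GradedFreeComplex k σ} (hmin : C.IsMinimal)
    (hC : ∀ i, LinearMap.ker (C.d i) = LinearMap.range (C.d (i + 1)))
    {I : Ideal (MvPolynomial σ k)}
    {e : (C.basis 0 →₀ MvPolynomial σ k) →ₗ[MvPolynomial σ k] MvPolynomial σ k}
    (he : Function.Injective e) (hI : LinearMap.range (e ∘ₗ C.d 0) = I)
    (hdeg : ∀ b, e (C.d 0 (Finsupp.single b 1)) ∈ monomialPiece k (C.deg 1 b)) :
    C.shift.IsMinimalResolution I (idealPiece I) := by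
  have hmem : ∀ x, (e ∘ₗ C.d 0) x ∈ I := fun x => by rw [← hI]; exact ⟨x, rfl⟩
  have hker : LinearMap.ker (LinearMap.codRestrict I (e ∘ₗ C.d 0) hmem) =
      LinearMap.range (C.d 1) := by
    rw [LinearMap.ker_codRestrict, LinearMap.ker_comp, LinearMap.ker_eq_bot.2 he,
      Submodule.comap_bot]
    exact hC 0
  refine ⟨⟨fun i => hC (i + 1), LinearMap.codRestrict I (e ∘ₗ C.d 0) hmem, ?_, hker, hdeg⟩,
    fun i => hmin (i + 1)⟩
  rintro ⟨y, hy⟩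
  rw [← hI] at hy
  obtain ⟨x, rfl⟩ := hy
  exact ⟨x, rfl⟩

end GradedFreeComplex

/-! ### Cells and their homogeneous basis elements -/

namespace SimplicialCplx

/-- The cell of a face with `i` vertices. -/
def mkCell {V : Type u} {X : SimplicialCplx V} {i : ℕ} (A : Finset V) (h : A ∈ X ∧ A.card = i) :
    X.Cells i := ⟨A, h⟩

theorem exists_eq_mkCell {V : Type u} {X : SimplicialCplx V} {i : ℕ} (A : X.Cells i) :
    ∃ (B : Finset V) (h : B ∈ X ∧ B.card = i), A = mkCell B h := ⟨A.1, A.2, rfl⟩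

/-- The empty face. -/
def emptyCell {V : Type u} {X : SimplicialCplx V} (hX : ∅ ∈ X) : X.Cells 0 := ⟨∅, hX, rfl⟩

theorem eq_emptyCell {V : Type u} {X : SimplicialCplx V} (hX : ∅ ∈ X) (A : X.Cells 0) :
    A = emptyCell hX :=
  Subtype.ext (Finset.card_eq_zero.1 A.2.2)

theorem injective_lapply_emptyCell {V σ : Type u} {k : Type v} [Field k] {X : SimplicialCplx V}
    (hX : ∅ ∈ X) : Function.Injective
    (Finsupp.lapply (emptyCell hX) :
      (X.Cells 0 →₀ MvPolynomial σ k) →ₗ[MvPolynomial σ k] MvPolynomial σ k) := by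
  intro x y h
  ext1 A
  rw [eq_emptyCell hX A]
  exact h

open Classical in
/-- The basis element of degree `α` in the summand of the face `A`. -/
def homogeneousBasis {V σ : Type u} (k : Type v) [Field k] (X : SimplicialCplx V) (label : V → (σ →₀ ℕ))
    (α : σ →₀ ℕ) (i : ℕ) (A : Finset V) : X.Cells i →₀ MvPolynomial σ k :=
  if h : A ∈ X ∧ A.card = i then
    Finsupp.single (mkCell A h) (monomial (α - faceLabel label A) 1) else 0

/-- The default value `0` is what the cone needs: inserting an apex already in `A` does not raise
the cardinality, and the cone term must vanish. -/
theorem homogeneousBasis_of_card_ne {V σ : Type u} {k : Type v} [Field k] {X : SimplicialCplx V}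
    {label : V → (σ →₀ ℕ)} {α : σ →₀ ℕ} {i : ℕ} {A : Finset V} (h : A.card ≠ i) :
    homogeneousBasis k X label α i A = 0 := dif_neg fun h2 => h h2.2

variable {V : Type u} [LinearOrder V] {σ : Type u} {X : SimplicialCplx V} {label : V → (σ →₀ ℕ)}

/-! ### Exactness of cellular complexes -/

/-- Every nonempty subcomplex of `X` of the faces with label at most `α` is a cone over its least
vertex `apex α`. -/
structure IsLeastApex (X : SimplicialCplx V) (label : V → (σ →₀ ℕ)) (apex : (σ →₀ ℕ) → V) :
    Prop where
  label_le : ∀ α v, label v ≤ α → label (apex α) ≤ α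
  le : ∀ α v, label v ≤ α → apex α ≤ v
  insert_mem : ∀ α v, label v ≤ α → ∀ A ∈ X, faceLabel label A ≤ α → insert (apex α) A ∈ X

/-- The cone construction `e_A ↦ e_{A ∪ u}`, with `u` depending on the degree. -/
def coneHomotopy (k : Type v) [Field k] (X : SimplicialCplx V) (label : V → (σ →₀ ℕ))
    (apex : (σ →₀ ℕ) → V) (i : ℕ) :
    (X.Cells i →₀ MvPolynomial σ k) →ₗ[k] (X.Cells (i + 1) →₀ MvPolynomial σ k) :=
  Finsupp.lsum k fun A => (basisMonomials σ k).constr k fun m =>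
    homogeneousBasis k X label (m + faceLabel label A.1) (i + 1)
      (insert (apex (m + faceLabel label A.1)) A.1)

variable {k : Type v} [Field k]

theorem coneHomotopy_single (apex : (σ →₀ ℕ) → V) (i : ℕ) (A : X.Cells i) (m : σ →₀ ℕ) :
    coneHomotopy k X label apex i (Finsupp.single A (monomial m 1)) =
      homogeneousBasis k X label (m + faceLabel label A.1) (i + 1)
        (insert (apex (m + faceLabel label A.1)) A.1) := by
  rw [coneHomotopy, Finsupp.lsum_single]
  exact (basisMonomials σ k).constr_basis k _ m

variable {α : σ →₀ ℕ} {i : ℕ} {A : Finset V}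

theorem coneHomotopy_homogeneousBasis (apex : (σ →₀ ℕ) → V) (hA : A ∈ X) (hc : A.card = i)
    (hα : faceLabel label A ≤ α) :
    coneHomotopy k X label apex i (homogeneousBasis k X label α i A) =
      homogeneousBasis k X label α (i + 1) (insert (apex α) A) := by
  rw [homogeneousBasis, dif_pos ⟨hA, hc⟩, coneHomotopy_single]
  simp only [mkCell, tsub_add_cancel_of_le hα]

theorem bdry_homogeneousBasis (hA : A ∈ X) (hc : A.card = i + 1)
    (hα : faceLabel label A ≤ α) :
    bdry k X label i (homogeneousBasis k X label α (i + 1) A) =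
      ∑ v ∈ A, ((sgn A v : ℤ) : k) • homogeneousBasis k X label α i (A.erase v) := by
  rw [homogeneousBasis, dif_pos ⟨hA, hc⟩, bdry_single, ← Finset.sum_attach A]
  simp only [mkCell]
  refine Finset.sum_congr rfl fun v _ => ?_
  have h : A.erase v.1 ∈ X ∧ (A.erase v.1).card = i :=
    ⟨X.lower (Finset.erase_subset _ _) hA, by rw [Finset.card_erase_of_mem v.2, hc]; rfl⟩
  rw [homogeneousBasis, dif_pos h, monomial_mul,
    tsub_add_tsub_cancel hα (faceLabel_erase_le _ _ _), Finsupp.smul_single, smul_monomial,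
    one_mul, smul_eq_mul, mul_one]
  rfl

theorem sgn_eq_one_of_le {u : V} (h : ∀ v ∈ A, u ≤ v) : sgn A u = 1 := by
  rw [sgn, Finset.filter_eq_empty_iff.2 (fun x hx => not_lt.2 (h x hx)), Finset.card_empty,
    pow_zero]

theorem sgn_insert_of_lt {u v : V} (hu : u ∉ A) (huv : u < v) :
    sgn (insert u A) v = -sgn A v := by
  rw [sgn, sgn, Finset.filter_insert, if_pos huv, Finset.card_insert_of_notMem (by simp [hu]),
    pow_succ, mul_neg_one]

theorem bdry_coneHomotopy_add {apex : (σ →₀ ℕ) → V} (hX : IsLeastApex X label apex)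
    (hA : A ∈ X) (hc : A.card = i + 1) (hα : faceLabel label A ≤ α) :
    bdry k X label (i + 1) (coneHomotopy k X label apex (i + 1)
        (homogeneousBasis k X label α (i + 1) A)) +
      coneHomotopy k X label apex i (bdry k X label i (homogeneousBasis k X label α (i + 1) A)) =
    homogeneousBasis k X label α (i + 1) A := by
  have hle : ∀ v ∈ A, label v ≤ α := fun v hv => (Finset.le_sup (f := label) hv).trans hα
  obtain ⟨w, hw⟩ : A.Nonempty := by rw [← Finset.card_pos]; omega
  have hu := hX.label_le α w (hle w hw)
  have humin : ∀ v ∈ A, apex α ≤ v := fun v hv => hX.le α v (hle v hv)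
  have hbd : coneHomotopy k X label apex i
      (bdry k X label i (homogeneousBasis k X label α (i + 1) A)) =
      ∑ v ∈ A, ((sgn A v : ℤ) : k) •
        homogeneousBasis k X label α (i + 1) (insert (apex α) (A.erase v)) := by
    rw [bdry_homogeneousBasis hA hc hα, map_sum]
    refine Finset.sum_congr rfl fun v hv => ?_
    rw [map_smul, coneHomotopy_homogeneousBasis apex (X.lower (Finset.erase_subset _ _) hA)
      (by rw [Finset.card_erase_of_mem hv, hc]; rfl) ((faceLabel_erase_le _ _ _).trans hα)]
  rw [hbd, coneHomotopy_homogeneousBasis apex hA hc hα]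
  -- If the apex is in `A`, the cone on `A` is zero and only the facet opposite the apex
  -- contributes, with sign `1` as the apex is least. Otherwise that facet of the cone is `A`, and
  -- all other terms cancel in pairs.
  by_cases huA : apex α ∈ A
  · rw [Finset.insert_eq_of_mem huA, homogeneousBasis_of_card_ne (i := i + 1 + 1) (by omega),
      map_zero, zero_add, Finset.sum_eq_single_of_mem _ huA, Finset.insert_erase huA,
      sgn_eq_one_of_le humin, Int.cast_one, one_smul]
    intro v hv hvu
    rw [Finset.insert_eq_of_mem (Finset.mem_erase.2 ⟨hvu.symm, huA⟩),
      homogeneousBasis_of_card_ne, smul_zero]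
    rw [Finset.card_erase_of_mem hv]
    omega
  · rw [bdry_homogeneousBasis (hX.insert_mem α w (hle w hw) A hA hα)
      (by rw [Finset.card_insert_of_notMem huA, hc]) (by
        rw [faceLabel, Finset.sup_insert]; exact sup_le hu hα),
      Finset.sum_insert huA, Finset.erase_insert huA, sgn_eq_one_of_le (by simpa using humin),
      Int.cast_one, one_smul, add_assoc, ← Finset.sum_add_distrib, Finset.sum_eq_zero, add_zero]
    intro v hv
    have hlt : apex α < v := lt_of_le_of_ne (humin v hv) fun h => huA (h ▸ hv)
    rw [sgn_insert_of_lt huA hlt, Finset.erase_insert_of_ne hlt.ne, ← add_smul]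
    simp

theorem ker_bdry_eq_range {apex : (σ →₀ ℕ) → V} (hX : IsLeastApex X label apex) (i : ℕ) :
    LinearMap.ker (bdry k X label i) = LinearMap.range (bdry k X label (i + 1)) := by
  apply le_antisymm
  · intro z hz
    -- The homotopy is only `k`-linear, as the apex varies with the degree; this suffices to exhibit
    -- a cycle as a boundary.
    have key : (bdry k X label (i + 1)).restrictScalars k ∘ₗ coneHomotopy k X label apex (i + 1) +
        coneHomotopy k X label apex i ∘ₗ (bdry k X label i).restrictScalars k =
        LinearMap.id := by
      refine Finsupp.lhom_ext' fun A => MvPolynomial.linearMap_ext fun m =>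
        LinearMap.ext_ring ?_
      have e : (Finsupp.single A (monomial m 1) : X.Cells (i + 1) →₀ MvPolynomial σ k) =
          homogeneousBasis k X label (m + faceLabel label A.1) (i + 1) A.1 := by
        rw [homogeneousBasis, dif_pos A.2, add_tsub_cancel_right]
        rfl
      simp only [LinearMap.comp_apply, LinearMap.add_apply, Finsupp.lsingle_apply,
        LinearMap.coe_restrictScalars, LinearMap.id_apply]
      rw [e]
      exact bdry_coneHomotopy_add hX A.2.1 A.2.2 le_add_self
    have h := LinearMap.congr_fun key z
    rw [LinearMap.add_apply, LinearMap.comp_apply, LinearMap.comp_apply,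
      LinearMap.coe_restrictScalars, LinearMap.coe_restrictScalars, LinearMap.mem_ker.1 hz,
      map_zero, add_zero] at h
    exact ⟨_, h⟩
  · rintro _ ⟨y, rfl⟩
    exact LinearMap.congr_fun (bdry_comp_bdry k X label i) y

/-! ### Minimality and augmentation of cellular complexes -/

theorem range_bdry_le
    (h : ∀ A ∈ X, ∀ v ∈ A, faceLabel label (A.erase v) ≠ faceLabel label A) (i : ℕ) :
    LinearMap.range (bdry k X label i) ≤
      Ideal.span (Set.range (MvPolynomial.X : σ → MvPolynomial σ k)) • ⊤ := by
  rintro _ ⟨z, rfl⟩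
  induction z using Finsupp.induction_linear with
  | zero => rw [map_zero]; exact zero_mem _
  | add x y hx hy => rw [map_add]; exact add_mem hx hy
  | single A c =>
    rw [bdry_single]
    refine sum_mem fun v _ => ?_
    rw [← mul_one (c * _), ← smul_eq_mul, ← Finsupp.smul_single]
    refine Submodule.smul_mem_smul (Ideal.mul_mem_left _ _ ?_) trivial
    rw [← Set.image_univ, mem_ideal_span_X_image]
    intro m hm
    classical
    rw [mem_support_iff, coeff_monomial] at hm
    split_ifs at hm with hm2
    -- A zero exponent would make the labels of the face and its facet equal.
    · by_contra! h0
      refine h A.1 A.2.1 v.1 v.2 (le_antisymm (faceLabel_erase_le _ _ _) ?_)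
      rw [← tsub_eq_zero_iff_le, hm2]
      ext s
      exact h0 s trivial
    · exact absurd rfl hm

theorem bdry_zero_single {v : V} (hv : {v} ∈ X) (hX : ∅ ∈ X) (c : MvPolynomial σ k) :
    bdry k X label 0 (Finsupp.single (mkCell {v} ⟨hv, Finset.card_singleton v⟩) c) =
      Finsupp.single (emptyCell hX) (c * monomial (label v) 1) := by
  have hmem : v ∈ (mkCell (X := X) (i := 0 + 1) {v} ⟨hv, Finset.card_singleton v⟩).1 :=
    Finset.mem_singleton_self v
  rw [bdry_single, Finset.sum_eq_single_of_mem ⟨v, hmem⟩ (Finset.mem_attach _ _)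
    (fun w _ hw => absurd (Subtype.ext (Finset.mem_singleton.1 w.2)) hw),
    eq_emptyCell hX (Cells.erase _ _ _)]
  simp only [mkCell]
  rw [sgn_eq_one_of_le (by simp)]
  simp [faceLabel, bot_eq_zero]

theorem range_lapply_comp_bdry (hX : ∅ ∈ X) :
    LinearMap.range (Finsupp.lapply (emptyCell hX) ∘ₗ bdry k X label 0) =
      Ideal.span {f | ∃ v, {v} ∈ X ∧ f = monomial (label v) 1} := by
  apply le_antisymm
  · rintro _ ⟨z, rfl⟩
    induction z using Finsupp.induction_linear with
    | zero => rw [map_zero]; exact zero_mem _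
    | add x y hx hy => rw [map_add]; exact add_mem hx hy
    | single A c =>
      obtain ⟨A, ⟨hA, hc⟩, rfl⟩ := exists_eq_mkCell A
      obtain ⟨v, rfl⟩ := Finset.card_eq_one.1 hc
      rw [LinearMap.comp_apply, bdry_zero_single hA hX, Finsupp.lapply_apply,
        Finsupp.single_eq_same]
      exact Ideal.mul_mem_left _ _ (Ideal.subset_span ⟨v, hA, rfl⟩)
  · refine Submodule.span_le.2 ?_
    rintro _ ⟨v, hv, rfl⟩
    exact ⟨Finsupp.single (mkCell {v} ⟨hv, Finset.card_singleton v⟩) 1, by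
      rw [LinearMap.comp_apply, bdry_zero_single hv hX, Finsupp.lapply_apply,
        Finsupp.single_eq_same, one_mul]⟩

variable {I : Ideal (MvPolynomial σ k)}

theorem ker_mkQ_comp_lapply (hX : ∅ ∈ X)
    (hI : Ideal.span {f | ∃ v, {v} ∈ X ∧ f = monomial (label v) 1} = I) :
    LinearMap.ker (Submodule.mkQ I ∘ₗ Finsupp.lapply (emptyCell hX)) =
      LinearMap.range (bdry k X label 0) := by
  rw [LinearMap.ker_comp, Submodule.ker_mkQ, ← hI, ← range_lapply_comp_bdry hX,
    LinearMap.range_comp, Submodule.comap_map_eq_of_injective (injective_lapply_emptyCell hX)]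

variable [Finite V]

theorem isMinimalResolution_cellularComplex {apex : (σ →₀ ℕ) → V}
    (hapex : IsLeastApex X label apex)
    (h : ∀ A ∈ X, ∀ v ∈ A, faceLabel label (A.erase v) ≠ faceLabel label A) (hX : ∅ ∈ X)
    (hI : Ideal.span {f | ∃ v, {v} ∈ X ∧ f = monomial (label v) 1} = I) :
    (cellularComplex k X label).IsMinimalResolution (MvPolynomial σ k ⧸ I) (quotientPiece I) := by
  refine ⟨⟨ker_bdry_eq_range hapex,
    Submodule.mkQ I ∘ₗ Finsupp.lapply (emptyCell hX), ?_, ker_mkQ_comp_lapply hX hI, ?_⟩, range_bdry_le h⟩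
  · refine (Submodule.mkQ_surjective I).comp fun p => ⟨Finsupp.single (emptyCell hX) p, ?_⟩
    exact Finsupp.single_eq_same
  · intro A
    obtain rfl := eq_emptyCell hX A
    refine ⟨1, ⟨1, ?_⟩, ?_⟩
    · change monomial (faceLabel label ∅) 1 = _
      simp [faceLabel, bot_eq_zero]
    · change Submodule.mkQ I 1 = Submodule.mkQ I ((Finsupp.single (emptyCell hX) 1) (emptyCell hX))
      rw [Finsupp.single_eq_same]

theorem isMinimalResolution_shift_cellularComplex {apex : (σ →₀ ℕ) → V}
    (hapex : IsLeastApex X label apex)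
    (h : ∀ A ∈ X, ∀ v ∈ A, faceLabel label (A.erase v) ≠ faceLabel label A) (hX : ∅ ∈ X)
    (hI : Ideal.span {f | ∃ v, {v} ∈ X ∧ f = monomial (label v) 1} = I) :
    (cellularComplex k X label).shift.IsMinimalResolution I (idealPiece I) := by
  refine GradedFreeComplex.isMinimalResolution_shift (C := cellularComplex k X label) (range_bdry_le h)
    (ker_bdry_eq_range hapex) (injective_lapply_emptyCell hX)
    ((range_lapply_comp_bdry hX).trans hI) fun A => ?_
  obtain ⟨A, hA, hc⟩ := A
  obtain ⟨v, rfl⟩ := Finset.card_eq_one.1 hc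
  change (bdry k X label 0 (Finsupp.single (mkCell {v} ⟨hA, hc⟩) 1)) (emptyCell hX) ∈
    monomialPiece k (faceLabel label {v})
  rw [bdry_zero_single hA hX, Finsupp.single_eq_same, one_mul, faceLabel, Finset.sup_singleton]
  exact ⟨1, rfl⟩

end SimplicialCplx

/-! ### Generators of the canonical ideal -/

section CanonicalIdeal

variable {A B : Type u}

open Classical in
theorem coGraph_apply [Finite A] [Finite B] (g : A →. B) (x : A × B) :
    coGraph g x = if x.2 ∈ g x.1 then 0 else 1 := rfl

theorem coGraph_eq_zero_iff [Finite A] [Finite B] {g : A →. B} {x : A × B} :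
    coGraph g x = 0 ↔ x.2 ∈ g x.1 := by
  simp [coGraph_apply]

theorem coGraph_apply_le_one [Finite A] [Finite B] (g : A →. B) (x : A × B) :
    coGraph g x ≤ 1 := by
  rw [coGraph_apply]
  split_ifs <;> simp

theorem coGraph_le_iff [Finite A] [Finite B] {g : A →. B} {α : A × B →₀ ℕ} :
    coGraph g ≤ α ↔ ∀ x, α x = 0 → x.2 ∈ g x.1 := by
  constructor
  · intro h x hx
    have := h x
    rw [hx, Nat.le_zero] at this
    exact coGraph_eq_zero_iff.1 this
  · intro h x
    by_cases hx : α x = 0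
    · rw [coGraph_eq_zero_iff.2 (h x hx)]; exact Nat.zero_le _
    · exact (coGraph_apply_le_one g x).trans (Nat.one_le_iff_ne_zero.2 hx)

theorem coGraph_injective [Finite A] [Finite B] :
    Function.Injective (coGraph : (A →. B) → (A × B →₀ ℕ)) := by
  intro g g' h
  refine PFun.ext fun a b => ?_
  have h1 := coGraph_eq_zero_iff (g := g) (x := (a, b))
  have h2 := coGraph_eq_zero_iff (g := g') (x := (a, b))
  rw [← h1, h, h2]

/-- Evaluating at the indicator of a face `τ` kills every generator, since no nonface is contained
in `τ`, but sends the monomial of `τ` to `1`. -/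
theorem prod_X_mem_stanleyReisnerIdeal_iff (k : Type v) [Field k] {V : Type u}
    {Δ : SimplicialCplx V} {τ : Finset V} :
    ∏ x ∈ τ, (X x : MvPolynomial V k) ∈ stanleyReisnerIdeal k Δ ↔ τ ∉ Δ := by
  classical
  refine ⟨fun h hτ => ?_, fun h => Ideal.subset_span ⟨τ, h, rfl⟩⟩
  let e : MvPolynomial V k →+* k := eval fun x => if x ∈ τ then 1 else 0
  have hle : stanleyReisnerIdeal k Δ ≤ RingHom.ker e := by
    refine Ideal.span_le.2 ?_
    rintro _ ⟨ρ, hρ, rfl⟩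
    obtain ⟨x, hx, hxτ⟩ : ∃ x ∈ ρ, x ∉ τ := by
      by_contra! h0
      exact hρ (Δ.lower h0 hτ)
    rw [SetLike.mem_coe, RingHom.mem_ker, map_prod]
    exact Finset.prod_eq_zero hx (by simp [e, hxτ])
  have h1 : e (∏ x ∈ τ, X x) = 1 := by
    rw [map_prod]
    exact Finset.prod_eq_one fun x hx => by simp [e, hx]
  have h0 : e (∏ x ∈ τ, X x) = 0 := hle h
  exact one_ne_zero (h1.symm.trans h0)

theorem mem_alexanderDual_iff {k : Type v} [Field k] {V : Type u} {I : Ideal (MvPolynomial V k)}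
    {p : MvPolynomial V k} : p ∈ alexanderDual I ↔
      ∀ τ : Finset V, ∏ x ∈ τ, (X x : MvPolynomial V k) ∈ I →
        p ∈ Ideal.span ((X : V → MvPolynomial V k) '' (τ : Set V)) := by
  simp only [alexanderDual, Submodule.mem_iInf]

theorem canonicalIdeal_eq_span (k : Type v) [Field k] [Finite A] [Finite B] (C : Set (A → B)) :
    canonicalIdeal k C = Ideal.span ((fun s => monomial s (1 : k)) ''
      {s | ∃ f ∈ C, s = coGraph (fun x => Part.some (f x) : A →. B)}) := by
  classical
  have := Fintype.ofFinite A
  have := Fintype.ofFinite B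
  apply le_antisymm
  · intro p hp
    rw [mem_ideal_span_monomial_image]
    intro m hm
    -- If the zero set of `m` were a nonface, membership in the corresponding prime would force a
    -- variable from it to divide `m`.
    obtain ⟨f, hf, hfm⟩ : (Finset.univ.filter fun x => m x = 0) ∈ canonicalSuboplex C := by
      by_contra h
      have h1 := mem_alexanderDual_iff.1 hp _ ((prod_X_mem_stanleyReisnerIdeal_iff k).2 h)
      obtain ⟨x, hx, hmx⟩ := mem_ideal_span_X_image.1 h1 m hm
      exact hmx (by simpa using hx)
    refine ⟨_, ⟨f, hf, rfl⟩, coGraph_le_iff.2 fun x hx => ?_⟩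
    rw [Part.mem_some_iff, hfm x (by simpa using hx)]
  · refine Ideal.span_le.2 ?_
    rintro _ ⟨_, ⟨f, hf, rfl⟩, rfl⟩
    refine mem_alexanderDual_iff.2 fun τ hτ => mem_ideal_span_X_image.2 fun m hm => ?_
    rw [mem_support_iff, coeff_monomial] at hm
    rw [prod_X_mem_stanleyReisnerIdeal_iff] at hτ
    obtain ⟨x, hx, hfx⟩ : ∃ x ∈ τ, f x.1 ≠ x.2 := by
      by_contra! h
      exact hτ ⟨f, hf, h⟩
    refine ⟨x, hx, ?_⟩
    split_ifs at hm with h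
    · subst h
      intro h0
      have h1 := coGraph_eq_zero_iff.1 h0
      exact hfx (Part.mem_some_iff.1 h1).symm
    · exact absurd rfl hm

end CanonicalIdeal

/-! ### Labels of flag faces -/

section Labels

variable {F : Type u} [Field F] {d : ℕ}

/-- The affine space of the linear functionals taking the value `x.2` at `x.1` for `x ∈ Z`. -/
def interpolationSpace (Z : Set ((Fin d → F) × F)) :
    AffineSubspace F (Module.Dual F (Fin d → F)) where
  carrier := {f | ∀ x ∈ Z, f x.1 = x.2}
  smul_vsub_vadd_mem' := by
    intro c f g h hf hg hh x hx
    simp [hf x hx, hg x hx, hh x hx]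

theorem mem_interpolationSpace {Z : Set ((Fin d → F) × F)} {f : Module.Dual F (Fin d → F)} :
    f ∈ interpolationSpace Z ↔ ∀ x ∈ Z, f x.1 = x.2 := Iff.rfl

theorem mem_dualCoannihilator_vectorSpan_iff {s : Set (Module.Dual F (Fin d → F))}
    {f₀ : Module.Dual F (Fin d → F)} (h₀ : f₀ ∈ s) {a : Fin d → F} :
    a ∈ (vectorSpan F s).dualCoannihilator ↔ ∀ f ∈ s, f a = f₀ a := by
  rw [Submodule.mem_dualCoannihilator]
  constructor
  · intro h f hf
    have := h (f -ᵥ f₀) (vsub_mem_vectorSpan F hf h₀)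
    simpa [sub_eq_zero] using this
  · intro h
    have : vectorSpan F s ≤ LinearMap.ker (Module.Dual.eval F (Fin d → F) a) := by
      rw [vectorSpan_eq_span_vsub_set_right F h₀, Submodule.span_le]
      rintro _ ⟨f, hf, rfl⟩
      simp [h f hf]
    exact fun φ hφ => this hφ

/-- Double annihilator: `v - f₀` kills every vector at which the members of `s` agree, hence lies in
the direction of the span. -/
theorem mem_affineSpan_of_forall {s : Set (Module.Dual F (Fin d → F))} (hs : s.Nonempty)
    {v : Module.Dual F (Fin d → F)} (h : ∀ a b, (∀ f ∈ s, f a = b) → v a = b) :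
    v ∈ affineSpan F s := by
  obtain ⟨f₀, h₀⟩ := hs
  have hv : v - f₀ ∈ vectorSpan F s := by
    rw [← Subspace.dualCoannihilator_dualAnnihilator_eq (W := vectorSpan F s),
      Submodule.mem_dualAnnihilator]
    intro a ha
    rw [LinearMap.sub_apply, h a (f₀ a) ((mem_dualCoannihilator_vectorSpan_iff h₀).1 ha), sub_self]
  rw [← direction_affineSpan] at hv
  simpa using AffineSubspace.vadd_mem_of_mem_direction hv (mem_affineSpan F h₀)

theorem mem_linearPFun_iff {ℓ : (Fin d → F) →ₗ.[F] F} {a : Fin d → F} {b : F} :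
    b ∈ linearPFun ℓ a ↔ ∃ h : a ∈ ℓ.domain, ℓ ⟨a, h⟩ = b := Iff.rfl

/-- The affine space of the linear functionals extending `ℓ`. -/
abbrev extensionSpace (ℓ : (Fin d → F) →ₗ.[F] F) :
    AffineSubspace F (Module.Dual F (Fin d → F)) :=
  interpolationSpace {x | x.2 ∈ linearPFun ℓ x.1}

theorem extensionSpace_nonempty (ℓ : (Fin d → F) →ₗ.[F] F) :
    (extensionSpace ℓ : Set (Module.Dual F (Fin d → F))).Nonempty := by
  obtain ⟨f, hf⟩ := LinearMap.exists_extend ℓ.toFun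
  refine ⟨f, ?_⟩
  rintro ⟨a, b⟩ ⟨h, hb⟩
  rw [← hb]
  exact LinearMap.congr_fun hf ⟨a, h⟩

theorem direction_extensionSpace (ℓ : (Fin d → F) →ₗ.[F] F) :
    (extensionSpace ℓ).direction = ℓ.domain.dualAnnihilator := by
  obtain ⟨f₀, h₀⟩ := extensionSpace_nonempty ℓ
  ext φ
  rw [AffineSubspace.mem_direction_iff_eq_vsub_right h₀, Submodule.mem_dualAnnihilator]
  constructor
  · rintro ⟨f, hf, rfl⟩ a ha
    have h1 := hf (a, ℓ ⟨a, ha⟩) ⟨ha, rfl⟩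
    have h2 := h₀ (a, ℓ ⟨a, ha⟩) ⟨ha, rfl⟩
    simp only at h1 h2
    rw [vsub_eq_sub, LinearMap.sub_apply, h1, h2, sub_self]
  · intro h
    refine ⟨φ + f₀, ?_, by simp⟩
    rintro ⟨a, b⟩ ⟨ha, hb⟩
    have h2 := h₀ (a, b) ⟨ha, hb⟩
    simp only at h2
    rw [LinearMap.add_apply, h a ha, zero_add, h2]

theorem finrank_direction_extensionSpace {ℓ : (Fin d → F) →ₗ.[F] F} {i : ℕ}
    (hi : i + Module.finrank F ℓ.domain = d) :
    Module.finrank F (extensionSpace ℓ).direction = i := by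
  rw [direction_extensionSpace]
  have := Subspace.finrank_add_finrank_dualAnnihilator_eq ℓ.domain
  rw [Module.finrank_fin_fun] at this
  omega

variable [Finite F]

/-- The exponent label of a linear functional. -/
abbrev dualLabel (f : Module.Dual F (Fin d → F)) : (Fin d → F) × F →₀ ℕ :=
  coGraph (fun x => Part.some (f x) : (Fin d → F) →. F)

theorem dualLabel_le_iff {f : Module.Dual F (Fin d → F)} {α : (Fin d → F) × F →₀ ℕ} :
    dualLabel f ≤ α ↔ f ∈ interpolationSpace {x | α x = 0} := by
  refine coGraph_le_iff.trans ?_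
  simp only [mem_interpolationSpace, Part.mem_some_iff, Set.mem_ofPred_eq, eq_comm]

variable [LinearOrder (Module.Dual F (Fin d → F))]

open SimplicialCplx

theorem faceLabel_dualLabel_eq_zero_iff {A : Finset (Module.Dual F (Fin d → F))}
    {x : (Fin d → F) × F} : faceLabel dualLabel A x = 0 ↔ ∀ f ∈ A, f x.1 = x.2 := by
  rw [faceLabel]
  induction A using Finset.induction_on with
  | empty => simp [bot_eq_zero]
  | insert f A hf ih =>
    rw [Finset.sup_insert, Finsupp.sup_apply, ← Nat.le_zero, sup_le_iff, Nat.le_zero, Nat.le_zero,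
      ih, Finset.forall_mem_insert]
    refine and_congr_left fun _ => coGraph_eq_zero_iff.trans ?_
    rw [Part.mem_some_iff, eq_comm]

theorem faceLabel_dualLabel_apply_le_one (A : Finset (Module.Dual F (Fin d → F)))
    (x : (Fin d → F) × F) : faceLabel dualLabel A x ≤ 1 := by
  rw [faceLabel]
  induction A using Finset.induction_on with
  | empty => simp [bot_eq_zero]
  | insert f A hf ih =>
    rw [Finset.sup_insert, Finsupp.sup_apply]
    exact sup_le (coGraph_apply_le_one _ _) ih

theorem faceLabel_dualLabel_eq_coGraph_iff {A : Finset (Module.Dual F (Fin d → F))}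
    {g : (Fin d → F) →. F} :
    faceLabel dualLabel A = coGraph g ↔ ∀ a b, (∀ f ∈ A, f a = b) ↔ b ∈ g a := by
  constructor
  · intro h a b
    rw [← coGraph_eq_zero_iff (x := (a, b)), ← h, faceLabel_dualLabel_eq_zero_iff]
  · intro h
    ext x
    have h1 := faceLabel_dualLabel_apply_le_one A x
    have h2 := coGraph_apply_le_one g x
    have h3 : faceLabel dualLabel A x = 0 ↔ coGraph g x = 0 := by
      rw [coGraph_eq_zero_iff, faceLabel_dualLabel_eq_zero_iff]
      exact h x.1 x.2
    omega

theorem exists_isLeastApex :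
    ∃ apex, IsLeastApex (flagComplex F d) (dualLabel (F := F) (d := d)) apex := by
  have key : ∀ α : (Fin d → F) × F →₀ ℕ, ∃ u : Module.Dual F (Fin d → F),
      (∃ v : Module.Dual F (Fin d → F), dualLabel v ≤ α) →
        IsLeast (interpolationSpace {x | α x = 0} : Set (Module.Dual F (Fin d → F))) u := by
    intro α
    by_cases h : ∃ v : Module.Dual F (Fin d → F), dualLabel v ≤ α
    · obtain ⟨v, hv⟩ := h
      obtain ⟨u, hu⟩ := exists_isLeast ⟨v, dualLabel_le_iff.1 hv⟩
      exact ⟨u, fun _ => hu⟩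
    -- No vertex lies below `α`, so the value of the apex is irrelevant.
    · exact ⟨0, fun h' => absurd h' h⟩
  choose apex hapex using key
  refine ⟨apex, fun α v hv => dualLabel_le_iff.2 (hapex α ⟨v, hv⟩).1,
    fun α v hv => (hapex α ⟨v, hv⟩).2 (dualLabel_le_iff.1 hv), fun α v hv A hA hAα => ?_⟩
  rw [mem_flagComplex_iff] at hA ⊢
  exact hA.insert_isLeast (hapex α ⟨v, hv⟩) fun f hf =>
    dualLabel_le_iff.1 ((Finset.le_sup (f := dualLabel) hf).trans hAα)

theorem faceLabel_erase_ne {A : Finset (Module.Dual F (Fin d → F))} (hA : A ∈ flagComplex F d)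
    {v : Module.Dual F (Fin d → F)} (hv : v ∈ A) :
    faceLabel dualLabel (A.erase v) ≠ faceLabel dualLabel A := by
  intro h
  have key : ∀ a b, (∀ f ∈ A.erase v, f a = b) → v a = b := fun a b hab =>
    faceLabel_dualLabel_eq_zero_iff (x := (a, b)).1
      (h ▸ faceLabel_dualLabel_eq_zero_iff (x := (a, b)).2 hab) v hv
  rcases (A.erase v).eq_empty_or_nonempty with h0 | h0
  · have h1 := key 0 1 (by simp [h0])
    rw [map_zero] at h1
    exact zero_ne_one h1
  · exact (mem_flagComplex_iff.1 hA).notMem_affineSpan_erase hv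
      (mem_affineSpan_of_forall h0.to_set key)

theorem empty_mem_flagComplex : ∅ ∈ flagComplex F d := mem_flagComplex_iff.2 isFlagFace_empty

theorem singleton_mem_flagComplex (f : Module.Dual F (Fin d → F)) : {f} ∈ flagComplex F d := by
  rw [mem_flagComplex_iff]
  have : IsLeast ((AffineSubspace.mk' f ⊥ : AffineSubspace F (Module.Dual F (Fin d → F))) :
      Set (Module.Dual F (Fin d → F))) f := by
    refine ⟨AffineSubspace.self_mem_mk' f ⊥, fun x hx => ?_⟩
    rw [SetLike.mem_coe, AffineSubspace.mem_mk', Submodule.mem_bot, vsub_eq_sub, sub_eq_zero] at hx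
    exact hx.ge
  simpa using isFlagFace_empty.insert_isLeast this (by simp)

theorem span_dualLabel_eq_canonicalIdeal (k : Type v) [Field k] :
    Ideal.span {p : MvPolynomial ((Fin d → F) × F) k |
      ∃ f : Module.Dual F (Fin d → F), {f} ∈ flagComplex F d ∧ p = monomial (dualLabel f) 1} =
    canonicalIdeal k (linfun F d) := by
  rw [canonicalIdeal_eq_span]
  congr 1
  ext p
  constructor
  · rintro ⟨f, -, rfl⟩
    exact ⟨_, ⟨f, ⟨f, rfl⟩, rfl⟩, rfl⟩
  · rintro ⟨_, ⟨_, ⟨f, rfl⟩, rfl⟩, rfl⟩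
    exact ⟨f, singleton_mem_flagComplex f, rfl⟩

/-! ### The flag resolution and the Betti numbers -/

theorem isMinimalResolution_flagResolution (k : Type v) [Field k] :
    (flagResolution F d k).IsMinimalResolution
      (MvPolynomial ((Fin d → F) × F) k ⧸ canonicalIdeal k (linfun F d))
      (quotientPiece (canonicalIdeal k (linfun F d))) := by
  obtain ⟨apex, hapex⟩ := exists_isLeastApex (F := F) (d := d)
  exact isMinimalResolution_cellularComplex hapex (fun A hA v hv => faceLabel_erase_ne hA hv)
    empty_mem_flagComplex (span_dualLabel_eq_canonicalIdeal k)

/-- Dropping the empty face shifts degrees by one, so homological degree `i` of the ideal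
corresponds to `i + 1` vertices. -/
theorem classBetti_eq_card (k : Type v) [Field k] (i : ℕ) (g : (Fin d → F) →. F) :
    classBetti k (linfun F d) i g = Nat.card {A : Finset (Module.Dual F (Fin d → F)) //
      IsFlagFace F A ∧ A.card = i + 1 ∧ faceLabel dualLabel A = coGraph g} := by
  obtain ⟨apex, hapex⟩ := exists_isLeastApex (F := F) (d := d)
  have h := isMinimalResolution_shift_cellularComplex (k := k) hapex
    (fun A hA v hv => faceLabel_erase_ne hA hv)
    empty_mem_flagComplex (span_dualLabel_eq_canonicalIdeal k)
  rw [classBetti, h.bettiNumber_eq]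
  exact Nat.card_congr
    { toFun := fun b => ⟨b.1.1, mem_flagComplex_iff.1 b.1.2.1, b.1.2.2, b.2⟩
      invFun := fun A => ⟨mkCell A.1 ⟨mem_flagComplex_iff.2 A.2.1, A.2.2.1⟩, A.2.2.2⟩
      left_inv := fun _ => rfl
      right_inv := fun _ => rfl }

/-- The members of `A` agree exactly on the coannihilator of `vectorSpan F A`, and affine
independence gives that span dimension `i`. -/
theorem exists_linearPFun_of_faceLabel_eq {A : Finset (Module.Dual F (Fin d → F))}
    (hA : IsFlagFace F A) {i : ℕ} (hc : A.card = i + 1) {g : (Fin d → F) →. F}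
    (hg : faceLabel dualLabel A = coGraph g) :
    ∃ ℓ : (Fin d → F) →ₗ.[F] F, g = linearPFun ℓ ∧ i + Module.finrank F ℓ.domain = d := by
  obtain ⟨f₀, h₀⟩ : A.Nonempty := by rw [← Finset.card_pos]; omega
  refine ⟨⟨(vectorSpan F (A : Set (Module.Dual F (Fin d → F)))).dualCoannihilator,
    f₀ ∘ₗ Submodule.subtype _⟩, coGraph_injective ?_, ?_⟩
  · rw [← hg, faceLabel_dualLabel_eq_coGraph_iff]
    intro a b
    rw [mem_linearPFun_iff]
    constructor
    · intro h
      exact ⟨(mem_dualCoannihilator_vectorSpan_iff h₀).2 fun f hf => (h f hf).trans (h f₀ h₀).symm,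
        h f₀ h₀⟩
    · rintro ⟨h, rfl⟩ f hf
      exact (mem_dualCoannihilator_vectorSpan_iff h₀).1 h f hf
  · have := Subspace.finrank_add_finrank_dualCoannihilator_eq
      (vectorSpan F (A : Set (Module.Dual F (Fin d → F))))
    rwa [hA.finrank_vectorSpan hc, Module.finrank_fin_fun] at this

theorem faceLabel_eq_coGraph_linearPFun_iff {A : Finset (Module.Dual F (Fin d → F))}
    (hA : IsFlagFace F A) {i : ℕ} (hc : A.card = i + 1) {ℓ : (Fin d → F) →ₗ.[F] F}
    (hi : i + Module.finrank F ℓ.domain = d) :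
    faceLabel dualLabel A = coGraph (linearPFun ℓ) ↔
      (A : Set (Module.Dual F (Fin d → F))) ⊆ extensionSpace ℓ := by
  rw [faceLabel_dualLabel_eq_coGraph_iff]
  constructor
  · intro h f hf x hx
    exact (h x.1 x.2).2 hx f hf
  · intro h a b
    refine ⟨fun hab => ?_, fun hab f hf => h hf (a, b) hab⟩
    -- By dimension `A` spans the extension space, so a value common to `A` is common to all
    -- extensions of `ℓ`.
    have hsp := hA.affineSpan_eq h (by rw [hc, finrank_direction_extensionSpace hi])
    have hle : extensionSpace ℓ ≤ interpolationSpace {(a, b)} := by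
      rw [← hsp, affineSpan_le]
      rintro f hf _ rfl
      exact hab f hf
    obtain ⟨f₀, h₀⟩ := extensionSpace_nonempty ℓ
    have hf₀ : f₀ a = b := hle h₀ (a, b) rfl
    -- If all extensions agree at `a`, every functional vanishing on the domain vanishes at `a`, so
    -- `a` is in the domain.
    have ha : a ∈ ℓ.domain := by
      rw [← Subspace.dualAnnihilator_dualCoannihilator_eq (W := ℓ.domain),
        Submodule.mem_dualCoannihilator]
      intro φ hφ
      rw [← direction_extensionSpace] at hφ
      have h1 : (φ + f₀) a = b := hle (AffineSubspace.vadd_mem_of_mem_direction hφ h₀) (a, b) rfl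
      rwa [LinearMap.add_apply, hf₀, add_eq_right] at h1
    refine ⟨ha, ?_⟩
    have := h₀ (a, ℓ ⟨a, ha⟩) ⟨ha, rfl⟩
    exact this.symm.trans hf₀

theorem classBetti_linearPFun (k : Type v) [Field k] {i : ℕ} {ℓ : (Fin d → F) →ₗ.[F] F}
    (hi : i + Module.finrank F ℓ.domain = d) :
    classBetti k (linfun F d) i (linearPFun ℓ) = flagCount (Nat.card F) i := by
  rw [classBetti_eq_card, ← card_isFlagFace i (extensionSpace ℓ) (extensionSpace_nonempty ℓ)
    (finrank_direction_extensionSpace hi)]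
  refine Nat.card_congr (Equiv.subtypeEquivRight fun A => and_congr_right fun hA => ?_)
  rw [and_comm]
  exact and_congr_left fun hc => faceLabel_eq_coGraph_linearPFun_iff hA hc hi

theorem exists_of_classBetti_ne_zero (k : Type v) [Field k] {i : ℕ} {g : (Fin d → F) →. F}
    (h : classBetti k (linfun F d) i g ≠ 0) :
    ∃ ℓ : (Fin d → F) →ₗ.[F] F, g = linearPFun ℓ ∧ i + Module.finrank F ℓ.domain = d := by
  rw [classBetti_eq_card] at h
  obtain ⟨A, hA, hc, hg⟩ := (Nat.card_ne_zero.1 h).1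
  exact exists_linearPFun_of_faceLabel_eq hA hc hg

end Labels

end

theorem mainTheorem5 {k : Type*} [Field k] {F : Type*} [Field F] [Finite F]
    (p : ℕ) (hp : Nat.card F = p) (d : ℕ) :
    (∀ _ : LinearOrder (Module.Dual F (Fin d → F)),
      (flagComplex F d).HasDim d ∧
      (flagResolution F d k).IsMinimalResolution
        (MvPolynomial ((Fin d → F) × F) k ⧸ canonicalIdeal k (linfun F d))
        (quotientPiece (canonicalIdeal k (linfun F d)))) ∧
    (∀ (i : ℕ) (g : (Fin d → F) →. F), classBetti k (linfun F d) i g ≠ 0 →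
      ∃ ℓ : (Fin d → F) →ₗ.[F] F, g = linearPFun ℓ ∧ i + Module.finrank F ℓ.domain = d) ∧
    (∀ (i : ℕ) (ℓ : (Fin d → F) →ₗ.[F] F), i + Module.finrank F ℓ.domain = d →
      classBetti k (linfun F d) i (linearPFun ℓ) = flagCount p i) := by
  subst hp
  refine ⟨fun _ => ⟨hasDim_flagComplex, isMinimalResolution_flagResolution k⟩, ?_⟩
  -- The Betti numbers involve no order, so an arbitrary one is chosen to count faces.
  let := IsWellOrder.linearOrder (α := Module.Dual F (Fin d → F)) WellOrderingRel
  exact ⟨fun i g h => exists_of_classBetti_ne_zero k h, fun i ℓ hi => classBetti_linearPFun k hi⟩
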